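/- **Setting.** Let $\mathsf c,L,N\ge 1$ and $d_0,\dots,d_L\ge 1$ be integers and let $\mathbf M\in\mathbb R^{\mathsf c\times\mathsf c}$ be orthogonal. For a tensor $T\in\mathbb R^{m\times n\times\mathsf c}$ put $M(T)=T\times_3\mathbf M$; the t-product $A*_M B$ is the tensor $M^{-1}(M(A)\odot M(B))$, where $\odot$ multiplies frontal slices. $\|\cdot\|_{\mathrm F}$ is the Euclidean norm of the vectorized tensor and $\sigma(x)=\max\{x,0\}$ acts entrywise. For weights $W^{(l)}\in\mathbb R^{d_l\times d_{l-1}\times \mathsf c}$ $(1\le l\le L)$ and $w\in\mathbb R^{\mathsf c d_L}$ let $f^{(0)}(x)=x$, $f^{(l)}(x)=\sigma(W^{(l)}*_M f^{(l-1)}(x))$ and $f(x)=w^\top\mathrm{vec}(f^{(L)}(x))$ for $x\in\mathbb R^{d_0\times1\times\mathsf c}$. Given positive constants $B_w,B_1,\dots,B_L$, let $\mathfrak F$ be the class of all such $f$ with $\|w\|_2\le B_w$ and $\|W^{(l)}\|_{\mathrm F}\le B_l$ for all $l$. **Data.** $P$ is a probability distribution on $\mathbb R^{d_0\times1\times\mathsf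 c}\times\{\pm1\}$ with $\|x\|_{\mathrm F}\le B_x$ almost surely, where $B_x>0$, and $S=\{(x_i,y_i)\}_{i=1}^N$ is drawn i.i.d. from $P$. **Adversary.** $R$ is a norm on $\mathbb R^{d_0\times1\times\mathsf c}$, $\xi\ge0$, and $\mathsf C_R:=\sup_{x\ne0}\|x\|_{\mathrm F}/R(x)$ is its compatibility constant with the Frobenius norm. Put $B_{\tilde f}:=(B_x+\xi\,\mathsf C_R)\,B_w\prod_{l=1}^L B_l$. **Loss.** $\ell(z,y)=\exp(-\varphi(yz))$ with $\varphi:\mathbb R\to\mathbb R$, such that (A.1) for a constant $B>0$, $\ell(h(x'),y)\in[0,B]$ for all $h\in\mathfrak F$, $y\in\{\pm1\}$ and all $x'$ with $R(x'-x)\le\xi$ for some $x$ with $\|x\|_{\mathrm F}\le B_x$; (A.2) $\varphi$ is $C^1$; (A.3) $\varphi'\ge0$; (A.4) for some $b\ge0$, $x\varphi'(x)$ is non-decreasing on $(b,\infty)$ and $x\varphi'(x)\to+\infty$ as $x\to+\infty$; (A.5) for this $b$, $\varphi$ restricted to $[b,\infty)$ has an inverse $g:[\varphi(b),\infty)\to[b,\infty)$,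 and there are $b_g\ge\max\{2\varphi(b),\varphi(2b)\}$ and $K\ge1$ such that $g'(x)\le Kg'(\theta x)$ and $\varphi'(y)\le K\varphi'(\theta y)$ for all $x>b_g$, $y>g(b_g)$ and $\theta\in[1/2,1)$. Put $L_\ell:=\sup_{|q|\le B_{\tilde f}}\varphi'(q)e^{-\varphi(q)}$. **Risks.** $\tilde\ell(f,(x,y)):=\max_{R(x'-x)\le\xi}\ell(f(x'),y)$, $\ \mathcal L^{\rm adv}(f):=\mathbb E_{(x,y)\sim P}\,\tilde\ell(f,(x,y))$, $\ \hat{\mathcal L}^{\rm adv}(f):=\frac1N\sum_{i=1}^N\tilde\ell(f,(x_i,y_i))$. **Theorem (adversarial generalization bound for t-NNs).** There is an absolute constant $C>0$ such that, in every setting as above and for every $t>0$, with probability at least $1-2e^{-t}$ over the draw of $S$, all $f\in\mathfrak F$ satisfy simultaneously $$\mathcal L^{\rm adv}(f)-\hat{\mathcal L}^{\rm adv}(f)\le\frac{C\,L_\ell\,B_{\tilde f}}{\sqrt N}\sqrt{\mathsf c\sum_{l=1}^{L}d_{l-1}d_l\,\log(3(L+1))}+3B\sqrt{\frac{t}{2N}}.$$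 -/

import Mathlib

open MeasureTheory Set Filter
open scoped Topology

noncomputable section

namespace TNN

/-- Real 3-way tensors of size `m × n × c`; the entry `T i j k` lies in the frontal slice `k`. -/
abbrev Tensor (m n c : ℕ) : Type := Fin m → Fin n → Fin c → ℝ

/-- Vectorization of a tensor. -/
def vec {m n c : ℕ} (T : Tensor m n c) : EuclideanSpace ℝ (Fin m × Fin n × Fin c) :=
  WithLp.toLp 2 fun p => T p.1 p.2.1 p.2.2

/-- Frobenius norm of a tensor. -/
def frobNorm {m n c : ℕ} (T : Tensor m n c) : ℝ := ‖vec T‖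

/-- The `k`-th frontal slice. -/
def slice {m n c : ℕ} (T : Tensor m n c) (k : Fin c) : Matrix (Fin m) (Fin n) ℝ :=
  Matrix.of fun i j => T i j k

/-- Mode-3 product with a `c × c` matrix. -/
def mode3 {m n c : ℕ} (T : Tensor m n c) (A : Matrix (Fin c) (Fin c) ℝ) : Tensor m n c :=
  fun i j k => ∑ k', A k k' * T i j k'

/-- Frontal-slice-wise product. -/
def sliceMul {m n p c : ℕ} (S : Tensor m n c) (T : Tensor n p c) : Tensor m p c :=
  fun i j k => (slice S k * slice T k) i j

/-- The t-product under the transform `T ↦ T ×₃ M`. -/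
def tProd {m n p c : ℕ} (M : Matrix (Fin c) (Fin c) ℝ) (S : Tensor m n c) (T : Tensor n p c) :
    Tensor m p c :=
  mode3 (sliceMul (mode3 S M) (mode3 T M)) M⁻¹

/-- Entrywise ReLU. -/
def relu {m n c : ℕ} (T : Tensor m n c) : Tensor m n c := fun i j k => max (T i j k) 0

/-- The output of the `l`-th layer. The weight tensor of layer `l + 1` is `W l`, of size
`d (l + 1) × d l × c`. -/
def feature {c : ℕ} {d : ℕ → ℕ} (M : Matrix (Fin c) (Fin c) ℝ)
    (W : (l : ℕ) → Tensor (d (l + 1)) (d l) c) (x : Tensor (d 0) 1 c) :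
    (l : ℕ) → Tensor (d l) 1 c
  | 0 => x
  | l + 1 => relu (tProd M (W l) (feature M W x l))

/-- The `L`-layer t-NN predictor with layer weights `W 0, …, W (L - 1)` and classification
weight `w`. -/
def predictor {c : ℕ} {d : ℕ → ℕ} (M : Matrix (Fin c) (Fin c) ℝ) (L : ℕ)
    (W : (l : ℕ) → Tensor (d (l + 1)) (d l) c)
    (w : EuclideanSpace ℝ (Fin (d L) × Fin 1 × Fin c)) (x : Tensor (d 0) 1 c) : ℝ :=
  inner ℝ w (vec (feature M W x L))

/-- The class of `L`-layer t-NNs with `‖w‖₂ ≤ Bw` and the weight tensor of layer `l + 1` bounded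
by `Bl l` in Frobenius norm, for `l < L`. -/
def tnnClass {c : ℕ} (d : ℕ → ℕ) (M : Matrix (Fin c) (Fin c) ℝ) (L : ℕ) (Bw : ℝ) (Bl : ℕ → ℝ) :
    Set (Tensor (d 0) 1 c → ℝ) :=
  {f | ∃ (W : (l : ℕ) → Tensor (d (l + 1)) (d l) c)
      (w : EuclideanSpace ℝ (Fin (d L) × Fin 1 × Fin c)),
      ‖w‖ ≤ Bw ∧ (∀ l < L, frobNorm (W l) ≤ Bl l) ∧ f = predictor M L W w}

/-- The loss `ℓ(z, y) = exp(-φ(y z))` of the prediction `z` for the label `y`. -/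
def loss (φ : ℝ → ℝ) (z y : ℝ) : ℝ := Real.exp (-φ (y * z))

/-- The inputs that an adversary can reach from `x`: the ball of radius `ξ` of the norm `R`. -/
def advBall {m c : ℕ} (R : Seminorm ℝ (Tensor m 1 c)) (ξ : ℝ) (x : Tensor m 1 c) :
    Set (Tensor m 1 c) :=
  {x' | R (x' - x) ≤ ξ}

/-- The adversarial loss of the predictor `f` on the example-label pair `z = (x, y)`. -/
def advLoss {m c : ℕ} (φ : ℝ → ℝ) (R : Seminorm ℝ (Tensor m 1 c)) (ξ : ℝ)
    (f : Tensor m 1 c → ℝ) (z : Tensor m 1 c × ℝ) : ℝ :=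
  sSup ((fun x' => loss φ (f x') z.2) '' advBall R ξ z.1)

/-- Population adversarial risk. -/
def advRisk {m c : ℕ} (φ : ℝ → ℝ) (R : Seminorm ℝ (Tensor m 1 c)) (ξ : ℝ)
    (P : Measure (Tensor m 1 c × ℝ)) (f : Tensor m 1 c → ℝ) : ℝ :=
  ∫ z, advLoss φ R ξ f z ∂P

/-- Empirical adversarial risk on the sample `S`. -/
def empAdvRisk {m c N : ℕ} (φ : ℝ → ℝ) (R : Seminorm ℝ (Tensor m 1 c)) (ξ : ℝ)
    (S : Fin N → Tensor m 1 c × ℝ) (f : Tensor m 1 c → ℝ) : ℝ :=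
  (N : ℝ)⁻¹ * ∑ i, advLoss φ R ξ f (S i)

/-- The compatibility constant of `R` with the Frobenius norm: the best constant `K` such that
`‖x‖_F ≤ K * R x` for all `x`. -/
def compatConst {m c : ℕ} (R : Seminorm ℝ (Tensor m 1 c)) : ℝ :=
  sSup {r | ∃ x : Tensor m 1 c, x ≠ 0 ∧ r = frobNorm x / R x}

/-- The bound `(B_x + ξ C_R) B_w ∏_l B_l` on the outputs of the networks at adversarial inputs. -/
def outputBound {m c : ℕ} (R : Seminorm ℝ (Tensor m 1 c)) (ξ Bx Bw : ℝ) (L : ℕ) (Bl : ℕ → ℝ) : ℝ :=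
  (Bx + ξ * compatConst R) * (Bw * ∏ l ∈ Finset.range L, Bl l)

/-- `sup_{|q| ≤ b} φ'(q) exp(-φ(q))`, the Lipschitz constant of the loss on `[-b, b]`. -/
def lossLip (φ : ℝ → ℝ) (b : ℝ) : ℝ :=
  sSup ((fun q => deriv φ q * Real.exp (-φ q)) '' Icc (-b) b)

/-- The assumptions on the loss `exp(-φ(y h(x)))` of the predictors `h` in the class `F`, at
inputs `x` in the set `A` and labels `y = ±1`. -/
structure LossAssumption {X : Type} (φ : ℝ → ℝ) (F : Set (X → ℝ)) (A : Set X) (B : ℝ) : Prop where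
  pos : 0 < B
  range : ∀ h ∈ F, ∀ x ∈ A, ∀ y : ℝ, (y = 1 ∨ y = -1) → loss φ (h x) y ∈ Icc 0 B
  smooth : ContDiff ℝ 1 φ
  deriv_nonneg : ∀ x, 0 ≤ deriv φ x
  growth : ∃ b : ℝ, 0 ≤ b ∧
    MonotoneOn (fun x => x * deriv φ x) (Ioi b) ∧
    Tendsto (fun x => x * deriv φ x) atTop atTop ∧
    ∃ g : ℝ → ℝ, MapsTo g (Ici (φ b)) (Ici b) ∧ InvOn g φ (Ici b) (Ici (φ b)) ∧
      ∃ bg K : ℝ, max (2 * φ b) (φ (2 * b)) ≤ bg ∧ 1 ≤ K ∧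
        ∀ θ ∈ Ico (1 / 2 : ℝ) 1,
          (∀ x ∈ Ioi bg, deriv g x ≤ K * deriv g (θ * x)) ∧
          (∀ y ∈ Ioi (g bg), deriv φ y ≤ K * deriv φ (θ * y))

end TNN

end

/-!
The proof is a chaining argument with Hoeffding tails, applied directly to the gap between the mean
and the empirical mean of the adversarial losses; neither symmetrization nor a bounded-difference
inequality is needed.

After normalization of the weights by their bounds, the class of t-NNs is the image of the unit ball
of a normed space of dimension `D = c ∑ d_{l-1} d_l + c d_L`, which is at most twice
`c ∑ d_{l-1} d_l` (`finrank_paramSpace_le`). As `M` is orthogonal, the t-product is submultiplicative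
for the Frobenius norm (`frobNorm_tProd_le`), and ReLU is a contraction. Hence on the inputs within
reach of the adversary the predictors are bounded by `b = outputBound`, and a change by `δ` of the
normalized weights changes them by at most `(L + 1) δ b` (`abs_paramPredictor_sub_le`). The supremum
over the adversarial ball and the loss, which is `lossLip φ b`-Lipschitz on `[-b, b]`, preserve such
estimates (`abs_advLoss_sub_le`). With `a = lossLip φ b * b`, the volumetric bound `(3 / ε) ^ D` for
nets of a unit ball (`exists_net_closedBall`) therefore gives nets at scale `r` of the adversarial
losses, in the uniform distance, of log-cardinality `D (log (3 (L + 1)) + log (a / r))`.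

Chaining along nets at the scales `s / 2 ^ k` (`measure_forall_gap_le_chain`) bounds all gaps at once
up to probability `exp (-t)` for the coarsest net and `exp (-t)` for all links together. The
fluctuation term must be at most `3 B √(t / 2N)`, with no contribution from `a`. This
is why the chain starts at a scale `s ≤ B / 3`: the coarsest net then contributes `B √(t / 2N)` and
the links together at most `2 B √(t / 2N)` (`measure_forall_gap_le_of_entropy`).
-/

namespace TNN

open ProbabilityTheory

/-! ### Finite nets of the unit ball -/

/-- Volume comparison: disjoint balls of radius `ε / 2` around the points of `s` all lie in the ball
of radius `1 + ε / 2 ≤ 3 / 2`. -/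
theorem card_le_of_separated_of_norm_le_one {E : Type*} [NormedAddCommGroup E] [NormedSpace ℝ E]
    [FiniteDimensional ℝ E] {ε : ℝ} (hε : 0 < ε) (hε1 : ε ≤ 1) (s : Finset E)
    (hs : ∀ x ∈ s, ‖x‖ ≤ 1) (hsep : ∀ x ∈ s, ∀ y ∈ s, x ≠ y → ε ≤ ‖x - y‖) :
    (s.card : ℝ) ≤ (3 / ε) ^ Module.finrank ℝ E := by
  borelize E
  let μ : Measure E := Measure.addHaar
  have hδ : 0 < ε / 2 := by positivity
  have hρ : (0 : ℝ) < 3 / 2 := by norm_num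
  have hdisj : Set.Pairwise (s : Set E)
      (Function.onFun Disjoint fun x => Metric.ball x (ε / 2)) := by
    intro x hx y hy hxy
    apply Metric.ball_disjoint_ball
    rw [dist_eq_norm, add_halves]
    exact hsep x hx y hy hxy
  have hsub : (⋃ x ∈ s, Metric.ball x (ε / 2)) ⊆ Metric.ball (0 : E) (3 / 2) := by
    refine iUnion₂_subset fun x hx => Metric.ball_subset_ball' ?_
    rw [dist_zero_right]
    linarith [hs x hx]
  have hvol : (s.card : ENNReal) * ENNReal.ofReal ((ε / 2) ^ Module.finrank ℝ E) *
      μ (Metric.ball 0 1) ≤ ENNReal.ofReal ((3 / 2) ^ Module.finrank ℝ E) * μ (Metric.ball 0 1) :=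
    calc
      _ = μ (⋃ x ∈ s, Metric.ball x (ε / 2)) := by
        rw [measure_biUnion_finset hdisj fun _ _ => measurableSet_ball]
        simp only [μ.addHaar_ball_of_pos _ hδ, Finset.sum_const, nsmul_eq_mul, mul_assoc]
      _ ≤ μ (Metric.ball (0 : E) (3 / 2)) := measure_mono hsub
      _ = _ := by simp only [μ.addHaar_ball_of_pos _ hρ]
  have hvol' := (ENNReal.mul_le_mul_iff_left (Metric.measure_ball_pos μ _ zero_lt_one).ne'
    measure_ball_lt_top.ne).1 hvol
  have hreal := ENNReal.toReal_le_of_le_ofReal (by positivity) hvol'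
  rw [ENNReal.toReal_mul, ENNReal.toReal_natCast, ENNReal.toReal_ofReal (by positivity)] at hreal
  rw [← le_div_iff₀ (by positivity), ← div_pow] at hreal
  rwa [show (3 / 2 : ℝ) / (ε / 2) = 3 / ε by field_simp] at hreal

/-- The unit ball of a `D`-dimensional normed space has an `ε`-net of at most `(3 / ε) ^ D` points:
a separated set of maximal cardinality is a net. -/
theorem exists_net_closedBall (E : Type*) [NormedAddCommGroup E] [NormedSpace ℝ E]
    [FiniteDimensional ℝ E] {ε : ℝ} (hε : 0 < ε) (hε1 : ε ≤ 1) :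
    ∃ T : Finset (Metric.closedBall (0 : E) 1),
      (T.card : ℝ) ≤ (3 / ε) ^ Module.finrank ℝ E ∧
        ∀ x : Metric.closedBall (0 : E) 1, ∃ y ∈ T, ‖(x : E) - y‖ ≤ ε := by
  classical
  let p : Finset (Metric.closedBall (0 : E) 1) → Prop := fun s =>
    ∀ x ∈ s, ∀ y ∈ s, x ≠ y → ε ≤ ‖(x : E) - y‖
  have hcard : ∀ s, p s → (s.card : ℝ) ≤ (3 / ε) ^ Module.finrank ℝ E := by
    intro s hs
    rw [← Finset.card_map (Function.Embedding.subtype _)]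
    refine card_le_of_separated_of_norm_le_one hε hε1 _ ?_ ?_
    · simp only [Finset.mem_map]
      rintro _ ⟨x, -, rfl⟩
      exact mem_closedBall_zero_iff.1 x.2
    · simp only [Finset.mem_map]
      rintro _ ⟨x, hx, rfl⟩ _ ⟨y, hy, rfl⟩ hxy
      exact hs x hx y hy fun h => hxy (by rw [h])
  obtain ⟨n, hn⟩ := exists_nat_ge ((3 / ε) ^ Module.finrank ℝ E)
  let q : ℕ → Prop := fun m => ∃ s, p s ∧ s.card = m
  have hq0 : q 0 := ⟨∅, by simp [p], rfl⟩
  obtain ⟨T, hT, hTc⟩ : q (Nat.findGreatest q n) := Nat.findGreatest_spec (Nat.zero_le n) hq0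
  refine ⟨T, hcard T hT, fun x => ?_⟩
  by_contra! hx
  have hxT : x ∉ T := fun h => by
    have := hx x h
    simp only [sub_self, norm_zero] at this
    linarith
  have hins : p (insert x T) := by
    intro y hy z hz hyz
    rw [Finset.mem_insert] at hy hz
    rcases hy with rfl | hy <;> rcases hz with rfl | hz
    · exact absurd rfl hyz
    · exact (hx z hz).le
    · rw [norm_sub_rev]
      exact (hx y hy).le
    · exact hT y hy z hz hyz
  have hle : (insert x T).card ≤ n := by exact_mod_cast (hcard _ hins).trans hn
  have := Nat.le_findGreatest (P := q) hle ⟨_, hins, rfl⟩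
  rw [Finset.card_insert_of_notMem hxT] at this
  omega

/-! ### Hoeffding's inequality for the generalization gap -/

/-- The generalization gap of `g` on the sample `S`: its mean minus its empirical mean. -/
noncomputable def gap {Z : Type*} [MeasurableSpace Z] (P : Measure Z) {N : ℕ} (g : Z → ℝ)
    (S : Fin N → Z) : ℝ :=
  ∫ z, g z ∂P - (N : ℝ)⁻¹ * ∑ i, g (S i)

theorem gap_sub {Z : Type*} [MeasurableSpace Z] {P : Measure Z} {N : ℕ} {g g' : Z → ℝ}
    (hg : Integrable g P) (hg' : Integrable g' P) (S : Fin N → Z) :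
    gap P (fun z => g z - g' z) S = gap P g S - gap P g' S := by
  simp only [gap, integral_sub hg hg', Finset.sum_sub_distrib]
  ring

section Gap

variable {Z : Type*} [MeasurableSpace Z] {P : Measure Z} [IsProbabilityMeasure P] {N : ℕ}

/-- One-sided Hoeffding inequality: a function whose values lie in an interval of length `w` has
gap at least `w √(h / 2N)` with probability at most `exp (-h)`. -/
theorem measure_gap_ge_le (hN : 0 < N) {g : Z → ℝ} (hg : AEMeasurable g P) {a w : ℝ} (hw : 0 < w)
    (hb : ∀ᵐ z ∂P, g z ∈ Icc a (a + w)) {h : ℝ} (hh : 0 ≤ h) :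
    Measure.pi (fun _ : Fin N => P) {S | w * √(h / (2 * N)) ≤ gap P g S} ≤
      ENNReal.ofReal (Real.exp (-h)) := by
  have hN' : (0 : ℝ) < N := by exact_mod_cast hN
  let Y : Z → ℝ := fun z => -g z - ∫ z, -g z ∂P
  have hY : HasSubgaussianMGF Y ((‖-a - -(a + w)‖₊ / 2) ^ 2) P := by
    refine hasSubgaussianMGF_of_mem_Icc hg.neg ?_
    filter_upwards [hb] with z hz
    exact ⟨neg_le_neg hz.2, neg_le_neg hz.1⟩
  have hYi : ∀ i : Fin N, HasSubgaussianMGF (fun S : Fin N → Z => Y (S i))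
      ((‖-a - -(a + w)‖₊ / 2) ^ 2) (Measure.pi fun _ => P) := by
    intro i
    refine HasSubgaussianMGF.of_map (Y := fun S : Fin N → Z => S i) (X := Y)
      (measurable_pi_apply i).aemeasurable ?_
    rwa [(measurePreserving_eval (fun _ : Fin N => P) i).map_eq]
  have hind : iIndepFun (fun (i : Fin N) (S : Fin N → Z) => Y (S i)) (Measure.pi fun _ => P) :=
    iIndepFun_pi (X := fun _ => Y) fun _ => hg.neg.sub_const _
  have key := HasSubgaussianMGF.measure_sum_ge_le_of_iIndepFun hind (s := Finset.univ)
    (fun i _ => hYi i) (ε := N * (w * √(h / (2 * N)))) (by positivity)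
  have hset : {S : Fin N → Z | w * √(h / (2 * N)) ≤ gap P g S} =
      {S | N * (w * √(h / (2 * N))) ≤ ∑ i, Y (S i)} := by
    ext S
    have : ∑ i, Y (S i) = N * gap P g S := by
      simp only [Y, gap, integral_neg, Finset.sum_sub_distrib, Finset.sum_neg_distrib,
        Finset.sum_const, Finset.card_univ, Fintype.card_fin, nsmul_eq_mul]
      field_simp
      ring
    simp only [Set.mem_ofPred_eq, this, mul_le_mul_iff_right₀ hN']
  rw [hset]
  refine (ENNReal.le_ofReal_iff_toReal_le (measure_ne_top _ _) (Real.exp_pos _).le).2 ?_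
  refine key.trans (le_of_eq ?_)
  congr 1
  have hsq : √(h / (2 * N)) ^ 2 = h / (2 * N) := Real.sq_sqrt (by positivity)
  have hwn : ‖-a - -(a + w)‖ = w := by
    rw [show -a - -(a + w) = w by ring, Real.norm_of_nonneg hw.le]
  simp only [Finset.sum_const, Finset.card_univ, Fintype.card_fin, nsmul_eq_mul, NNReal.coe_mul,
    NNReal.coe_natCast, NNReal.coe_pow, NNReal.coe_div, coe_nnnorm, NNReal.coe_ofNat, hwn]
  rw [mul_pow, mul_pow, hsq]
  field_simp

/-- Union bound: at most `exp h` functions with values in intervals of length `w` have all gaps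
below `w √((h + u) / 2N)`, except with probability at most `exp (-u)`. -/
theorem measure_biUnion_gap_ge_le (hN : 0 < N) {κ : Type*} (T : Finset κ) {g : κ → Z → ℝ}
    (hg : ∀ j ∈ T, AEMeasurable (g j) P) {a w : ℝ} (hw : 0 < w)
    (hb : ∀ j ∈ T, ∀ᵐ z ∂P, g j z ∈ Icc a (a + w)) {h u : ℝ} (hT : (T.card : ℝ) ≤ Real.exp h)
    (hhu : 0 ≤ h + u) :
    Measure.pi (fun _ : Fin N => P) (⋃ j ∈ T, {S | w * √((h + u) / (2 * N)) ≤ gap P (g j) S}) ≤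
      ENNReal.ofReal (Real.exp (-u)) := by
  refine (measure_biUnion_finset_le T _).trans ?_
  refine (Finset.sum_le_sum fun j hj => measure_gap_ge_le hN (hg j hj) hw (hb j hj) hhu).trans ?_
  rw [Finset.sum_const, nsmul_eq_mul, ← ENNReal.ofReal_natCast, ← ENNReal.ofReal_mul (by positivity)]
  refine ENNReal.ofReal_le_ofReal ?_
  calc (T.card : ℝ) * Real.exp (-(h + u)) ≤ Real.exp h * Real.exp (-(h + u)) := by gcongr
    _ = Real.exp (-u) := by rw [← Real.exp_add]; ring_nf

/-- Functions at distance at most `δ` on a set of full measure that contains the sample have gaps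
that differ by at most `2 δ`. -/
theorem gap_le_gap_add (hN : 0 < N) {g g' : Z → ℝ} (hg : Integrable g P) (hg' : Integrable g' P)
    {Z₀ : Set Z} (hZ₀ : ∀ᵐ z ∂P, z ∈ Z₀) {δ : ℝ} (hδ : ∀ z ∈ Z₀, |g z - g' z| ≤ δ)
    {S : Fin N → Z} (hS : ∀ i, S i ∈ Z₀) : gap P g S ≤ gap P g' S + 2 * δ := by
  have hN' : (0 : ℝ) < N := by exact_mod_cast hN
  have h1 : ∫ z, (g z - g' z) ∂P ≤ δ := by
    have := integral_mono_ae (hg.sub hg') (integrable_const δ)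
      (hZ₀.mono fun z hz => (le_abs_self _).trans (hδ z hz))
    simpa using this
  have h2 : -δ ≤ (N : ℝ)⁻¹ * ∑ i, (g (S i) - g' (S i)) := by
    have : ∑ _i : Fin N, (-δ) ≤ ∑ i, (g (S i) - g' (S i)) :=
      Finset.sum_le_sum fun i _ => (abs_le.1 (hδ _ (hS i))).1
    simp only [Finset.sum_const, Finset.card_univ, Fintype.card_fin, nsmul_eq_mul] at this
    rw [← div_eq_inv_mul, le_div_iff₀ hN']
    linarith
  have h3 := gap_sub (N := N) hg hg' S
  have h4 : gap P (fun z => g z - g' z) S ≤ 2 * δ := by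
    rw [gap]
    linarith
  linarith

/-! ### Chaining -/

/-- Chaining with Hoeffding tails. The finite sets `T k` are `s / 2 ^ k`-nets of the class, in the
uniform distance on a set `Z₀` of full measure. A union bound over `T 0` and over the links from
`T k` to `T (k + 1)` costs `exp (-t)` and `∑ₖ 2 ^ (-k-1) exp (-t)`. -/
theorem measure_forall_gap_le_chain (hN : 0 < N) {ι : Type*} {G : ι → Z → ℝ}
    (hG : ∀ i, AEMeasurable (G i) P) {Z₀ : Set Z} (hZ₀ : ∀ᵐ z ∂P, z ∈ Z₀) {B s : ℝ} (hB : 0 < B)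
    (hs : 0 < s) (hGB : ∀ i, ∀ z ∈ Z₀, G i z ∈ Icc 0 B) (T : ℕ → Finset ι)
    (hT : ∀ k i, ∃ j ∈ T k, ∀ z ∈ Z₀, |G i z - G j z| ≤ s / 2 ^ k) {h : ℕ → ℝ}
    (hh : ∀ k, 0 ≤ h k) (hcard : ∀ k, ((T k).card : ℝ) ≤ Real.exp (h k)) {t : ℝ} (ht : 0 < t) :
    ENNReal.ofReal (1 - 2 * Real.exp (-t)) ≤ Measure.pi (fun _ : Fin N => P)
      {S | ∀ i n, gap P (G i) S ≤ B * √((h 0 + t) / (2 * N)) +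
        ∑ k ∈ Finset.range n, 3 * (s / 2 ^ k) *
          √((h k + h (k + 1) + (t + (k + 1 : ℕ) * Real.log 2)) / (2 * N)) + 2 * (s / 2 ^ n)} := by
  classical
  set μ := Measure.pi (fun _ : Fin N => P) with hμ
  have hlog2 : 0 < Real.log 2 := Real.log_pos one_lt_two
  have hint : ∀ i, Integrable (G i) P := fun i =>
    Integrable.of_mem_Icc 0 B (hG i) (hZ₀.mono fun z hz => hGB i z hz)
  let A₀ : Set (Fin N → Z) := ⋃ j ∈ T 0, {S | B * √((h 0 + t) / (2 * N)) ≤ gap P (G j) S}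
  -- The best approximations of one function in `T k` and `T (k + 1)` are at distance at most
  -- `s / 2 ^ k + s / 2 ^ (k + 1)`.
  let links : ℕ → Finset (ι × ι) := fun k => (T k ×ˢ T (k + 1)).filter fun p =>
    ∀ z ∈ Z₀, |G p.2 z - G p.1 z| ≤ 3 / 2 * (s / 2 ^ k)
  let A : ℕ → Set (Fin N → Z) := fun k => ⋃ p ∈ links k,
    {S | 3 * (s / 2 ^ k) * √((h k + h (k + 1) + (t + (k + 1 : ℕ) * Real.log 2)) / (2 * N)) ≤
      gap P (fun z => G p.2 z - G p.1 z) S}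
  let A' : Set (Fin N → Z) := {S | ¬ ∀ i, S i ∈ Z₀}
  have hA₀ : μ A₀ ≤ ENNReal.ofReal (Real.exp (-t)) := by
    refine measure_biUnion_gap_ge_le (a := 0) hN (T 0) (fun j _ => hG j) hB (fun j _ => ?_)
      (hcard 0) (by linarith [hh 0])
    filter_upwards [hZ₀] with z hz
    simpa using hGB j z hz
  have hA : ∀ k, μ (A k) ≤ ENNReal.ofReal (Real.exp (-t) * (1 / 2) * (1 / 2) ^ k) := by
    intro k
    have hpow : Real.exp (-t) * (1 / 2) * (1 / 2) ^ k =
        Real.exp (-(t + (k + 1 : ℕ) * Real.log 2)) := by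
      rw [neg_add, Real.exp_add, Real.exp_neg (_ * Real.log 2), Real.exp_nat_mul,
        Real.exp_log two_pos, mul_assoc, ← pow_succ', one_div, inv_pow]
    rw [hpow]
    refine measure_biUnion_gap_ge_le (a := -(3 / 2 * (s / 2 ^ k))) hN (links k)
      (fun p _ => (hG p.2).sub (hG p.1)) (by positivity) (fun p hp => ?_) ?_ ?_
    · filter_upwards [hZ₀] with z hz
      have := abs_le.1 ((Finset.mem_filter.1 hp).2 z hz)
      refine ⟨this.1, this.2.trans (le_of_eq ?_)⟩
      ring
    · calc ((links k).card : ℝ) ≤ (T k ×ˢ T (k + 1)).card := by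
            exact_mod_cast Finset.card_filter_le _ _
        _ = (T k).card * (T (k + 1)).card := by rw [Finset.card_product]; push_cast; rfl
        _ ≤ Real.exp (h k) * Real.exp (h (k + 1)) :=
            mul_le_mul (hcard k) (hcard _) (by positivity) (Real.exp_pos _).le
        _ = _ := (Real.exp_add _ _).symm
    · have := hh k
      have := hh (k + 1)
      positivity
  have hA' : μ A' = 0 := by
    have : ∀ᵐ S ∂μ, ∀ i, S i ∈ Z₀ := by
      rw [ae_all_iff]
      intro i
      exact (measurePreserving_eval (fun _ : Fin N => P) i).quasiMeasurePreserving.ae hZ₀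
    exact this
  have hAU : μ (⋃ k, A k) ≤ ENNReal.ofReal (Real.exp (-t)) := by
    refine (measure_iUnion_le A).trans ((ENNReal.tsum_le_tsum hA).trans (le_of_eq ?_))
    have hsum : HasSum (fun k : ℕ => Real.exp (-t) * (1 / 2) * (1 / 2) ^ k) (Real.exp (-t)) := by
      have := hasSum_geometric_two.mul_left (Real.exp (-t) * (1 / 2))
      rwa [mul_assoc _ _ (2 : ℝ), one_div_mul_cancel (two_ne_zero), mul_one] at this
    rw [← ENNReal.ofReal_tsum_of_nonneg (fun k => by positivity) hsum.summable, hsum.tsum_eq]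
  have hbad : μ (A₀ ∪ (⋃ k, A k) ∪ A') ≤ ENNReal.ofReal (2 * Real.exp (-t)) := by
    refine (measure_union_le _ _).trans ?_
    rw [hA', add_zero, two_mul, ENNReal.ofReal_add (Real.exp_pos _).le (Real.exp_pos _).le]
    exact (measure_union_le _ _).trans (add_le_add hA₀ hAU)
  have hgood : ∀ S ∉ A₀ ∪ (⋃ k, A k) ∪ A', ∀ i n, gap P (G i) S ≤ B * √((h 0 + t) / (2 * N)) +
        ∑ k ∈ Finset.range n, 3 * (s / 2 ^ k) *
          √((h k + h (k + 1) + (t + (k + 1 : ℕ) * Real.log 2)) / (2 * N)) + 2 * (s / 2 ^ n) := by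
    intro S hS i n
    simp only [mem_union, not_or] at hS
    obtain ⟨⟨hS0, hS1⟩, hS2⟩ := hS
    have hS2 : ∀ i, S i ∈ Z₀ := not_not.1 hS2
    choose π hπT hπ using fun k => hT k i
    have hchain : ∀ n, gap P (G (π n)) S ≤ B * √((h 0 + t) / (2 * N)) +
        ∑ k ∈ Finset.range n, 3 * (s / 2 ^ k) *
          √((h k + h (k + 1) + (t + (k + 1 : ℕ) * Real.log 2)) / (2 * N)) := by
      intro n
      induction n with
      | zero =>
        simp only [A₀, mem_iUnion, Set.mem_ofPred_eq, not_exists, not_le] at hS0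
        simpa using (hS0 _ (hπT 0)).le
      | succ k ih =>
        have hlink : (π k, π (k + 1)) ∈ links k := by
          refine Finset.mem_filter.2 ⟨Finset.mem_product.2 ⟨hπT k, hπT (k + 1)⟩, fun z hz => ?_⟩
          have h1 := hπ k z hz
          have h2 := hπ (k + 1) z hz
          rw [pow_succ, ← div_div] at h2
          rw [abs_le] at *
          constructor <;> dsimp only <;> linarith [h1.1, h1.2, h2.1, h2.2]
        simp only [A, mem_iUnion, Set.mem_ofPred_eq, not_exists, not_le] at hS1
        have := (hS1 k _ hlink).le
        rw [gap_sub (hint _) (hint _)] at this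
        rw [Finset.sum_range_succ]
        linarith
    exact (gap_le_gap_add hN (hint i) (hint (π n)) hZ₀ (hπ n) hS2).trans
      (by linarith [hchain n])
  -- The event itself need not be measurable; subadditivity of the outer measure is enough.
  have hcompl : ∀ U V : Set (Fin N → Z), Vᶜ ⊆ U → μ V ≤ ENNReal.ofReal (2 * Real.exp (-t)) →
      ENNReal.ofReal (1 - 2 * Real.exp (-t)) ≤ μ U := by
    intro U V hUV hV
    rw [ENNReal.ofReal_sub _ (by positivity), ENNReal.ofReal_one, tsub_le_iff_right]
    calc (1 : ENNReal) = μ univ := by rw [hμ, measure_univ]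
      _ ≤ μ (U ∪ V) := measure_mono fun S _ => by
        by_cases hSV : S ∈ V
        · exact Or.inr hSV
        · exact Or.inl (hUV hSV)
      _ ≤ μ U + μ V := measure_union_le _ _
      _ ≤ _ := by gcongr
  exact hcompl _ _ (fun S hS => hgood S hS) hbad

end Gap

theorem sum_range_add_three_div_two_pow_le (n : ℕ) :
    ∑ k ∈ Finset.range n, ((k : ℝ) + 3) / 2 ^ k ≤ 8 := by
  have : ∑ k ∈ Finset.range n, ((k : ℝ) + 3) / 2 ^ k = 8 - (2 * n + 8) / 2 ^ n := by
    induction n with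
    | zero => norm_num
    | succ n ih =>
      rw [Finset.sum_range_succ, ih, pow_succ]
      push_cast
      field_simp
      ring
  rw [this]
  have : (0 : ℝ) ≤ (2 * n + 8) / 2 ^ n := by positivity
  linarith

theorem sum_range_one_div_two_pow_le (n : ℕ) :
    ∑ k ∈ Finset.range n, (1 : ℝ) / 2 ^ k ≤ 2 := by
  have := sum_geometric_two_le n
  simpa only [one_div_pow] using this

/-- The entropies `D (ℓ + log (a / s) + k log 2)` of the nets at scales `s / 2 ^ k` are summable
against the scales, and `s log (a / s) ≤ a` absorbs the dependence on `s`. -/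
theorem chain_sum_le {D l a s B t m : ℝ} (hD : 1 ≤ D) (hl : 1 ≤ l) (hs : 0 < s) (hsa : s ≤ a)
    (hsB : s ≤ B / 3) (ht : 0 < t) (hm : 0 < m) {h : ℕ → ℝ}
    (hh : ∀ k : ℕ, h k ≤ D * (l + Real.log (a / s) + k * Real.log 2))
    (h0 : B ^ 2 * h 0 ≤ 9 * a ^ 2 * (D * l)) (n : ℕ) :
    B * √((h 0 + t) / m) + ∑ k ∈ Finset.range n, 3 * (s / 2 ^ k) *
        √((h k + h (k + 1) + (t + (k + 1 : ℕ) * Real.log 2)) / m) ≤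
      27 * a * √(D * l) / √m + 3 * B * √(t / m) := by
  have ha : 0 < a := hs.trans_le hsa
  have hB : 0 < B := by linarith
  set r := √(D * l) with hr
  have hr0 : 0 ≤ r := Real.sqrt_nonneg _
  have hr2 : r ^ 2 = D * l := Real.sq_sqrt (by positivity)
  set Λ := Real.log (a / s) with hΛ
  have hΛ0 : 0 ≤ Λ := Real.log_nonneg ((one_le_div hs).2 hsa)
  have hsΛ : s * Λ ≤ a - s := by
    have := Real.log_le_sub_one_of_pos (div_pos ha hs)
    calc s * Λ ≤ s * (a / s - 1) := by gcongr
      _ = a - s := by field_simp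
  have hlog2 : Real.log 2 ≤ 1 := by
    have := Real.log_le_sub_one_of_pos (zero_lt_two' ℝ)
    linarith
  have hlog2' : 0 < Real.log 2 := Real.log_pos one_lt_two
  have hDl : 1 ≤ D * l := one_le_mul_of_one_le_of_one_le hD hl
  have hh' : ∀ k : ℕ, h k ≤ D * l * (1 + Λ + k) := by
    intro k
    refine (hh k).trans ?_
    have h1 : Λ ≤ l * Λ := le_mul_of_one_le_left hΛ0 hl
    have h2 : k * Real.log 2 ≤ l * k := by
      have : (k : ℝ) * Real.log 2 ≤ k := mul_le_of_le_one_right (Nat.cast_nonneg k) hlog2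
      exact this.trans (le_mul_of_one_le_left (Nat.cast_nonneg k) hl)
    calc D * (l + Λ + k * Real.log 2) ≤ D * (l + l * Λ + l * k) := by gcongr
      _ = _ := by ring
  have hsplit : ∀ x, √((x + t) / m) ≤ √x / √m + √(t / m) := by
    intro x
    rw [add_div, Real.sqrt_le_left (by positivity), add_sq, Real.sq_sqrt (by positivity)]
    rcases le_total 0 x with hx | hx
    · rw [div_pow, Real.sq_sqrt hx, Real.sq_sqrt hm.le]
      have : 0 ≤ 2 * (√x / √m) * √(t / m) := by positivity
      linarith
    · have : x / m ≤ 0 := div_nonpos_of_nonpos_of_nonneg hx hm.le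
      have : 0 ≤ 2 * (√x / √m) * √(t / m) := by positivity
      have := sq_nonneg (√x / √m)
      linarith
  have hfirst : B * √((h 0 + t) / m) ≤ 3 * a * r / √m + B * √(t / m) := by
    have h1 : B * √(h 0) ≤ 3 * a * r := by
      rw [← Real.sqrt_sq hB.le, ← Real.sqrt_mul (sq_nonneg B), Real.sqrt_le_left (by positivity)]
      refine h0.trans (le_of_eq ?_)
      rw [mul_pow, hr2]
      ring
    calc B * √((h 0 + t) / m) ≤ B * (√(h 0) / √m + √(t / m)) := by gcongr; exact hsplit _
      _ = B * √(h 0) / √m + B * √(t / m) := by ring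
      _ ≤ _ := by gcongr
  have hterm : ∀ k : ℕ, 3 * (s / 2 ^ k) *
      √((h k + h (k + 1) + (t + (k + 1 : ℕ) * Real.log 2)) / m) ≤
      3 * a * r / √m * (((k : ℝ) + 3) / 2 ^ k) + B * √(t / m) * (1 / 2 ^ k) := by
    intro k
    have hy : h k + h (k + 1) + (k + 1 : ℕ) * Real.log 2 ≤ D * l * (2 + 2 * Λ + 3 * (k + 1)) := by
      have h1 := hh' k
      have h2 := hh' (k + 1)
      have h3 : (k + 1 : ℕ) * Real.log 2 ≤ D * l * (k + 1 : ℕ) := by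
        rw [mul_comm]
        exact mul_le_mul_of_nonneg_right (hlog2.trans hDl) (Nat.cast_nonneg _)
      push_cast at *
      linarith
    have h1 : s * √(h k + h (k + 1) + (k + 1 : ℕ) * Real.log 2) ≤ a * r * (k + 3) := by
      rw [← Real.sqrt_sq hs.le, ← Real.sqrt_mul (sq_nonneg s), Real.sqrt_le_left (by positivity)]
      calc s ^ 2 * (h k + h (k + 1) + (k + 1 : ℕ) * Real.log 2)
          ≤ s ^ 2 * (D * l * (2 + 2 * Λ + 3 * (k + 1))) := by gcongr
        _ = D * l * (s * (2 * s + 2 * (s * Λ) + 3 * (k + 1) * s)) := by ring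
        _ ≤ D * l * (a * (2 * s + 2 * (a - s) + 3 * (k + 1) * a)) := by gcongr
        _ = D * l * (a ^ 2 * (3 * k + 5)) := by ring
        _ ≤ D * l * (a ^ 2 * (k + 3) ^ 2) := by
            have : (3 * k + 5 : ℝ) ≤ (k + 3) ^ 2 := by nlinarith [(Nat.cast_nonneg k : (0 : ℝ) ≤ k)]
            gcongr
        _ = (a * r * (k + 3)) ^ 2 := by rw [mul_pow, mul_pow, hr2]; ring
    have h2 := hsplit (h k + h (k + 1) + (k + 1 : ℕ) * Real.log 2)
    rw [show h k + h (k + 1) + (t + (k + 1 : ℕ) * Real.log 2) =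
      h k + h (k + 1) + (k + 1 : ℕ) * Real.log 2 + t by ring]
    calc _ ≤ 3 * (s / 2 ^ k) *
          (√(h k + h (k + 1) + (k + 1 : ℕ) * Real.log 2) / √m + √(t / m)) := by gcongr
      _ = 3 * (s * √(h k + h (k + 1) + (k + 1 : ℕ) * Real.log 2)) / √m / 2 ^ k +
          3 * s * √(t / m) * (1 / 2 ^ k) := by ring
      _ ≤ 3 * (a * r * (k + 3)) / √m / 2 ^ k + B * √(t / m) * (1 / 2 ^ k) := by
          gcongr
          linarith
      _ = _ := by ring
  have hsum : ∑ k ∈ Finset.range n, 3 * (s / 2 ^ k) *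
      √((h k + h (k + 1) + (t + (k + 1 : ℕ) * Real.log 2)) / m) ≤
      3 * a * r / √m * 8 + B * √(t / m) * 2 := by
    refine (Finset.sum_le_sum fun k _ => hterm k).trans ?_
    rw [Finset.sum_add_distrib, ← Finset.mul_sum, ← Finset.mul_sum]
    gcongr
    · exact sum_range_add_three_div_two_pow_le n
    · exact sum_range_one_div_two_pow_le n
  calc _ ≤ 3 * a * r / √m + B * √(t / m) + (3 * a * r / √m * 8 + B * √(t / m) * 2) :=
        add_le_add hfirst hsum
    _ = _ := by ring

section Uniform

variable {Z : Type*} [MeasurableSpace Z] {P : Measure Z} [IsProbabilityMeasure P] {N : ℕ}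

/-- Uniform bound for the gap over a class with entropy numbers of order `D (l + log (a / r))` at
scale `r`, and values in `[0, B]`. The chain starts at a scale `s ≤ B / 3`, so that all its links
together add at most `2 B √(t / 2N)` to the deviation. If `a` is small compared with `B`, a single
function serves as the coarsest net; otherwise the net at scale `B / 3` is cheap enough. -/
theorem measure_forall_gap_le_of_entropy (hN : 0 < N) {ι : Type*} {G : ι → Z → ℝ}
    (hG : ∀ i, AEMeasurable (G i) P) {Z₀ : Set Z} (hZ₀ : ∀ᵐ z ∂P, z ∈ Z₀) {B a D l : ℝ}
    (hB : 0 < B) (ha : 0 < a) (hD : 1 ≤ D) (hl : 1 ≤ l)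
    (hGB : ∀ i, ∀ z ∈ Z₀, G i z ∈ Icc 0 B)
    (i₀ : ι) (hi₀ : ∀ i, ∀ z ∈ Z₀, |G i z - G i₀ z| ≤ a)
    (hnet : ∀ r, 0 < r → r ≤ a → ∃ T : Finset ι,
      (T.card : ℝ) ≤ Real.exp (D * (l + Real.log (a / r))) ∧
      ∀ i, ∃ j ∈ T, ∀ z ∈ Z₀, |G i z - G j z| ≤ r) {t : ℝ} (ht : 0 < t) :
    ENNReal.ofReal (1 - 2 * Real.exp (-t)) ≤ Measure.pi (fun _ : Fin N => P)
      {S | ∀ i, gap P (G i) S ≤ 27 * a * √(D * l) / √(2 * N) + 3 * B * √(t / (2 * N))} := by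
  have hN' : (0 : ℝ) < 2 * N := by positivity
  have hlog2 : 0 < Real.log 2 := Real.log_pos one_lt_two
  obtain ⟨s, hs, hsa, hsB, T, h, hT, hh0, hcard, hh, h0⟩ : ∃ s : ℝ, 0 < s ∧ s ≤ a ∧ s ≤ B / 3 ∧
      ∃ (T : ℕ → Finset ι) (h : ℕ → ℝ),
      (∀ k i, ∃ j ∈ T k, ∀ z ∈ Z₀, |G i z - G j z| ≤ s / 2 ^ k) ∧ (∀ k, 0 ≤ h k) ∧
      (∀ k, ((T k).card : ℝ) ≤ Real.exp (h k)) ∧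
      (∀ k : ℕ, h k ≤ D * (l + Real.log (a / s) + k * Real.log 2)) ∧
      B ^ 2 * h 0 ≤ 9 * a ^ 2 * (D * l) := by
    have hnets : ∀ s, 0 < s → s ≤ a → ∃ T : ℕ → Finset ι, ∀ k : ℕ,
        ((T k).card : ℝ) ≤ Real.exp (D * (l + Real.log (a / s) + k * Real.log 2)) ∧
        ∀ i, ∃ j ∈ T k, ∀ z ∈ Z₀, |G i z - G j z| ≤ s / 2 ^ k := by
      intro s hs hsa
      refine ⟨fun k => (hnet (s / 2 ^ k) (by positivity)
        ((div_le_self hs.le (one_le_pow₀ one_le_two)).trans hsa)).choose, fun k => ?_⟩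
      obtain ⟨h1, h2⟩ := (hnet (s / 2 ^ k) (by positivity)
        ((div_le_self hs.le (one_le_pow₀ one_le_two)).trans hsa)).choose_spec
      refine ⟨h1.trans (le_of_eq ?_), h2⟩
      rw [div_div_eq_mul_div, mul_div_right_comm, Real.log_mul (by positivity) (by positivity),
        Real.log_pow, add_assoc]
    have hnonneg : ∀ s, 0 < s → s ≤ a → ∀ k : ℕ,
        0 ≤ D * (l + Real.log (a / s) + k * Real.log 2) := by
      intro s hs hsa k
      have : 0 ≤ Real.log (a / s) := Real.log_nonneg ((one_le_div hs).2 hsa)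
      positivity
    rcases le_total B (3 * a) with hBa | hBa
    · have hs : 0 < B / 3 := by positivity
      have hsa : B / 3 ≤ a := by linarith
      obtain ⟨T, hT⟩ := hnets (B / 3) hs hsa
      refine ⟨B / 3, hs, hsa, le_rfl, T, _, fun k => (hT k).2, hnonneg _ hs hsa,
        fun k => (hT k).1, fun k => le_rfl, ?_⟩
      set s := B / 3 with hs_def
      have hlog := Real.log_le_sub_one_of_pos (div_pos ha hs)
      have hBs : B = 3 * s := by rw [hs_def]; ring
      have hl0 : 0 ≤ Real.log (a / s) := Real.log_nonneg ((one_le_div hs).2 hsa)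
      calc B ^ 2 * (D * (l + Real.log (a / s) + (0 : ℕ) * Real.log 2))
          = 9 * s ^ 2 * (D * (l + Real.log (a / s))) := by rw [hBs]; push_cast; ring
        _ ≤ 9 * s ^ 2 * (D * (l + l * (a / s - 1))) := by
            gcongr
            exact hlog.trans (le_mul_of_one_le_left (hl0.trans hlog) hl)
        _ = 9 * (s * a) * (D * l) := by field_simp; ring
        _ ≤ 9 * a ^ 2 * (D * l) := by
            rw [sq]
            gcongr
    · obtain ⟨T, hT⟩ := hnets a ha le_rfl
      refine ⟨a, ha, le_rfl, by linarith, fun k => if k = 0 then {i₀} else T k,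
        fun k => if k = 0 then 0 else D * (l + Real.log (a / a) + k * Real.log 2),
        fun k i => ?_, fun k => ?_, fun k => ?_, fun k => ?_, ?_⟩
      · by_cases hk : k = 0
        · simpa [hk] using hi₀ i
        · simpa only [hk, if_false] using (hT k).2 i
      · dsimp only
        split_ifs
        · exact le_rfl
        · exact hnonneg a ha le_rfl k
      · by_cases hk : k = 0
        · simp [hk]
        · simpa only [hk, if_false] using (hT k).1
      · dsimp only
        split_ifs
        · exact hnonneg a ha le_rfl k
        · exact le_rfl
      · simp only [if_true, mul_zero]
        positivity
  refine (measure_forall_gap_le_chain hN hG hZ₀ hB hs hGB T hT hh0 hcard ht).trans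
    (measure_mono fun S hS i => ?_)
  have hlim : Tendsto (fun n : ℕ => 27 * a * √(D * l) / √(2 * N) + 3 * B * √(t / (2 * N)) +
      2 * (s / 2 ^ n)) atTop
      (𝓝 (27 * a * √(D * l) / √(2 * N) + 3 * B * √(t / (2 * N)) + 2 * 0)) := by
    refine tendsto_const_nhds.add (Tendsto.const_mul 2 ?_)
    exact tendsto_const_nhds.div_atTop (tendsto_pow_atTop_atTop_of_one_lt one_lt_two)
  rw [mul_zero, add_zero] at hlim
  refine ge_of_tendsto' hlim fun n => (hS i n).trans ?_
  exact add_le_add_left (chain_sum_le hD hl hs hsa hsB ht hN' hh h0 n) _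

/-- Uniform bound for the gap over a class that is indexed by the unit ball of a normed space of
dimension `D ≥ 1`, of diameter of order `a`, and `κ a`-Lipschitz in the index. -/
theorem measure_forall_gap_le_of_lipschitz (hN : 0 < N) (E : Type*) [NormedAddCommGroup E]
    [NormedSpace ℝ E] [FiniteDimensional ℝ E] (hE : 0 < Module.finrank ℝ E)
    {G : Metric.closedBall (0 : E) 1 → Z → ℝ} (hG : ∀ θ, AEMeasurable (G θ) P)
    {Z₀ : Set Z} (hZ₀ : ∀ᵐ z ∂P, z ∈ Z₀) {B a κ : ℝ} (hB : 0 < B) (ha : 0 < a) (hκ : 1 ≤ κ)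
    (hGB : ∀ θ, ∀ z ∈ Z₀, G θ z ∈ Icc 0 B)
    (θ₀ : Metric.closedBall (0 : E) 1) (hθ₀ : ∀ θ, ∀ z ∈ Z₀, |G θ z - G θ₀ z| ≤ a)
    (hlip : ∀ θ θ', ∀ z ∈ Z₀, |G θ z - G θ' z| ≤ κ * a * ‖(θ : E) - θ'‖) {t : ℝ} (ht : 0 < t) :
    ENNReal.ofReal (1 - 2 * Real.exp (-t)) ≤ Measure.pi (fun _ : Fin N => P)
      {S | ∀ θ, gap P (G θ) S ≤ 27 * a * √(Module.finrank ℝ E * Real.log (3 * κ)) / √(2 * N) +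
        3 * B * √(t / (2 * N))} := by
  have hκ0 : 0 < κ := by linarith
  refine measure_forall_gap_le_of_entropy hN hG hZ₀ hB ha (by exact_mod_cast hE) ?_ hGB θ₀ hθ₀
    ?_ ht
  · rw [Real.le_log_iff_exp_le (by positivity)]
    linarith [Real.exp_one_lt_d9]
  · intro r hr hra
    have hε : 0 < r / (κ * a) := by positivity
    have hε1 : r / (κ * a) ≤ 1 := by
      rw [div_le_one (by positivity)]
      exact hra.trans (le_mul_of_one_le_left ha.le hκ)
    obtain ⟨T, hT, hT'⟩ := exists_net_closedBall E hε hε1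
    refine ⟨T, hT.trans (le_of_eq ?_), fun θ => ?_⟩
    · rw [← Real.log_mul (by positivity) (by positivity), Real.exp_nat_mul,
        Real.exp_log (by positivity)]
      congr 1
      field_simp
    · obtain ⟨θ', hθ', hle⟩ := hT' θ
      refine ⟨θ', hθ', fun z hz => (hlip θ θ' z hz).trans ?_⟩
      rw [le_div_iff₀ (by positivity)] at hle
      linarith

end Uniform

/-! ### Norms of tensors and Lipschitz estimates for t-NNs -/

section Tensor

variable {m n p c : ℕ}

theorem vec_sub (S T : Tensor m n c) : vec (S - T) = vec S - vec T := rfl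

theorem vec_add (S T : Tensor m n c) : vec (S + T) = vec S + vec T := rfl

theorem frobNorm_nonneg (T : Tensor m n c) : 0 ≤ frobNorm T := norm_nonneg _

theorem frobNorm_zero : frobNorm (0 : Tensor m n c) = 0 :=
  norm_zero (E := EuclideanSpace ℝ (Fin m × Fin n × Fin c))

theorem frobNorm_add_le (S T : Tensor m n c) : frobNorm (S + T) ≤ frobNorm S + frobNorm T := by
  rw [frobNorm, vec_add]
  exact norm_add_le _ _

theorem frobNorm_sq (T : Tensor m n c) : frobNorm T ^ 2 = ∑ i, ∑ j, ∑ k, T i j k ^ 2 := by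
  simp only [frobNorm, EuclideanSpace.real_norm_sq_eq, vec, Fintype.sum_prod_type]

theorem mode3_sub (S T : Tensor m n c) (A : Matrix (Fin c) (Fin c) ℝ) :
    mode3 (S - T) A = mode3 S A - mode3 T A := by
  funext i j k
  simp only [mode3, Pi.sub_apply, mul_sub, Finset.sum_sub_distrib]

theorem sliceMul_sub_left (S S' : Tensor m n c) (T : Tensor n p c) :
    sliceMul (S - S') T = sliceMul S T - sliceMul S' T := by
  funext i j k
  simp [sliceMul, slice, Matrix.mul_apply, sub_mul, Finset.sum_sub_distrib]

theorem sliceMul_sub_right (S : Tensor m n c) (T T' : Tensor n p c) :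
    sliceMul S (T - T') = sliceMul S T - sliceMul S T' := by
  funext i j k
  simp [sliceMul, slice, Matrix.mul_apply, mul_sub, Finset.sum_sub_distrib]

theorem tProd_sub_left (M : Matrix (Fin c) (Fin c) ℝ) (S S' : Tensor m n c) (T : Tensor n p c) :
    tProd M (S - S') T = tProd M S T - tProd M S' T := by
  simp only [tProd, mode3_sub, sliceMul_sub_left]

theorem tProd_sub_right (M : Matrix (Fin c) (Fin c) ℝ) (S : Tensor m n c) (T T' : Tensor n p c) :
    tProd M S (T - T') = tProd M S T - tProd M S T' := by
  simp only [tProd, mode3_sub, sliceMul_sub_right]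

theorem frobNorm_mode3 {A : Matrix (Fin c) (Fin c) ℝ} (hA : A ∈ Matrix.orthogonalGroup (Fin c) ℝ)
    (T : Tensor m n c) : frobNorm (mode3 T A) = frobNorm T := by
  have hvec : ∀ v : Fin c → ℝ, ∑ k, (∑ k', A k k' * v k') ^ 2 = ∑ k, v k ^ 2 := by
    intro v
    have h1 : (A.mulVec v) ⬝ᵥ (A.mulVec v) = v ⬝ᵥ v := by
      rw [Matrix.dotProduct_mulVec, Matrix.vecMul_mulVec,
        (Matrix.mem_orthogonalGroup_iff' (Fin c) ℝ).1 hA, Matrix.vecMul_one]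
    simpa only [dotProduct, Matrix.mulVec, ← sq] using h1
  refine (sq_eq_sq₀ (frobNorm_nonneg _) (frobNorm_nonneg _)).1 ?_
  simp only [frobNorm_sq, mode3, hvec]

theorem frobNorm_sliceMul_le (S : Tensor m n c) (T : Tensor n p c) :
    frobNorm (sliceMul S T) ≤ frobNorm S * frobNorm T := by
  refine (sq_le_sq₀ (frobNorm_nonneg _)
    (mul_nonneg (frobNorm_nonneg _) (frobNorm_nonneg _))).1 ?_
  let s : Fin c → ℝ := fun k => ∑ i, ∑ j, S i j k ^ 2
  let u : Fin c → ℝ := fun k => ∑ j, ∑ q, T j q k ^ 2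
  have hs : ∀ k, 0 ≤ s k := fun k => by positivity
  have hu : ∀ k, 0 ≤ u k := fun k => by positivity
  have hS : frobNorm S ^ 2 = ∑ k, s k := by
    rw [frobNorm_sq, Finset.sum_comm_cycle]
  have hT : frobNorm T ^ 2 = ∑ k, u k := by
    rw [frobNorm_sq, Finset.sum_comm_cycle]
  rw [mul_pow, hS, hT, frobNorm_sq, Finset.sum_comm_cycle]
  calc ∑ k, ∑ i, ∑ q, sliceMul S T i q k ^ 2
      ≤ ∑ k, ∑ i, ∑ q, (∑ j, S i j k ^ 2) * ∑ j, T j q k ^ 2 := by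
        gcongr with k _ i _ q _
        simp only [sliceMul, slice, Matrix.mul_apply, Matrix.of_apply]
        exact Finset.sum_mul_sq_le_sq_mul_sq _ _ _
    _ = ∑ k, s k * u k := by
        refine Finset.sum_congr rfl fun k _ => ?_
        simp only [← Finset.mul_sum, ← Finset.sum_mul, s, u]
        rw [Finset.sum_comm (f := fun q j => T j q k ^ 2)]
    _ ≤ ∑ k, s k * ∑ k, u k := by
        refine Finset.sum_le_sum fun k _ => mul_le_mul_of_nonneg_left ?_ (hs k)
        exact Finset.single_le_sum (f := u) (fun k _ => hu k) (Finset.mem_univ k)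
    _ = (∑ k, s k) * ∑ k, u k := by rw [Finset.sum_mul]

theorem frobNorm_tProd_le {M : Matrix (Fin c) (Fin c) ℝ}
    (hM : M ∈ Matrix.orthogonalGroup (Fin c) ℝ) (S : Tensor m n c) (T : Tensor n p c) :
    frobNorm (tProd M S T) ≤ frobNorm S * frobNorm T := by
  have hM' : M⁻¹ ∈ Matrix.orthogonalGroup (Fin c) ℝ := by
    rw [Matrix.inv_eq_left_inv ((Matrix.mem_orthogonalGroup_iff' (Fin c) ℝ).1 hM)]
    exact Unitary.star_mem hM
  rw [tProd, frobNorm_mode3 hM']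
  refine (frobNorm_sliceMul_le _ _).trans (le_of_eq ?_)
  rw [frobNorm_mode3 hM, frobNorm_mode3 hM]

theorem frobNorm_le_of_abs_le {S T : Tensor m n c} (h : ∀ i j k, |S i j k| ≤ |T i j k|) :
    frobNorm S ≤ frobNorm T := by
  refine (sq_le_sq₀ (frobNorm_nonneg _) (frobNorm_nonneg _)).1 ?_
  rw [frobNorm_sq, frobNorm_sq]
  exact Finset.sum_le_sum fun i _ => Finset.sum_le_sum fun j _ => Finset.sum_le_sum fun k _ =>
    sq_le_sq.2 (h i j k)

theorem frobNorm_relu_le (T : Tensor m n c) : frobNorm (relu T) ≤ frobNorm T :=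
  frobNorm_le_of_abs_le fun i j k => by
    simpa [relu] using abs_max_sub_max_le_abs (T i j k) 0 0

theorem frobNorm_relu_sub_le (S T : Tensor m n c) :
    frobNorm (relu S - relu T) ≤ frobNorm (S - T) :=
  frobNorm_le_of_abs_le fun i j k => abs_max_sub_max_le_abs (S i j k) (T i j k) 0

end Tensor

section Network

variable {c L : ℕ} {d : ℕ → ℕ} {M : Matrix (Fin c) (Fin c) ℝ}
  {W W' : (l : ℕ) → Tensor (d (l + 1)) (d l) c} {Bl : ℕ → ℝ}

theorem continuous_feature (M : Matrix (Fin c) (Fin c) ℝ)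
    (W : (l : ℕ) → Tensor (d (l + 1)) (d l) c) (l : ℕ) :
    Continuous fun x : Tensor (d 0) 1 c => feature M W x l := by
  induction l with
  | zero => exact continuous_id
  | succ l ih =>
    unfold feature relu tProd mode3 sliceMul slice
    simp only [Matrix.mul_apply, Matrix.of_apply]
    fun_prop

theorem continuous_predictor (M : Matrix (Fin c) (Fin c) ℝ) (L : ℕ)
    (W : (l : ℕ) → Tensor (d (l + 1)) (d l) c)
    (w : EuclideanSpace ℝ (Fin (d L) × Fin 1 × Fin c)) : Continuous (predictor M L W w) := by
  refine continuous_const.inner ((PiLp.continuous_toLp 2 _).comp ?_)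
  have := continuous_feature M W L
  fun_prop

/-- The `l`-th layer depends only on the weights of the layers below it. -/
theorem feature_congr (x : Tensor (d 0) 1 c) {l : ℕ} (h : ∀ k < l, W k = W' k) :
    feature M W x l = feature M W' x l := by
  induction l with
  | zero => rfl
  | succ l ih => rw [feature, feature, ih fun k hk => h k (hk.trans (Nat.lt_succ_self l)),
      h l (Nat.lt_succ_self l)]

theorem frobNorm_feature_le (hM : M ∈ Matrix.orthogonalGroup (Fin c) ℝ) (x : Tensor (d 0) 1 c)
    {l : ℕ} (hW : ∀ k < l, frobNorm (W k) ≤ Bl k) :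
    frobNorm (feature M W x l) ≤ (∏ k ∈ Finset.range l, Bl k) * frobNorm x := by
  induction l with
  | zero => simp [feature]
  | succ l ih =>
    have hl := hW l (Nat.lt_succ_self l)
    rw [Finset.prod_range_succ, feature]
    calc _ ≤ frobNorm (W l) * frobNorm (feature M W x l) :=
          (frobNorm_relu_le _).trans (frobNorm_tProd_le hM _ _)
      _ ≤ Bl l * ((∏ k ∈ Finset.range l, Bl k) * frobNorm x) :=
          mul_le_mul hl (ih fun k hk => hW k (hk.trans (Nat.lt_succ_self l))) (frobNorm_nonneg _)
            ((frobNorm_nonneg _).trans hl)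
      _ = _ := by ring

/-- A relative change by `δ` of the weights of each layer accumulates to a relative change by `l δ`
of the output of the `l`-th layer. -/
theorem frobNorm_feature_sub_le (hM : M ∈ Matrix.orthogonalGroup (Fin c) ℝ)
    (x : Tensor (d 0) 1 c) {δ : ℝ} {l : ℕ} (hW : ∀ k < l, frobNorm (W k) ≤ Bl k)
    (hW' : ∀ k < l, frobNorm (W' k) ≤ Bl k) (hδ : ∀ k < l, frobNorm (W k - W' k) ≤ δ * Bl k) :
    frobNorm (feature M W x l - feature M W' x l) ≤
      l * δ * ((∏ k ∈ Finset.range l, Bl k) * frobNorm x) := by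
  induction l with
  | zero => simp [feature, frobNorm_zero]
  | succ l ih =>
    have hlt := Nat.lt_succ_self l
    have hl := hW l hlt
    have ih := ih (fun k hk => hW k (hk.trans hlt)) (fun k hk => hW' k (hk.trans hlt))
      (fun k hk => hδ k (hk.trans hlt))
    have hf := frobNorm_feature_le hM x fun k (hk : k < l) => hW' k (hk.trans hlt)
    have hsplit : tProd M (W l) (feature M W x l) - tProd M (W' l) (feature M W' x l) =
        tProd M (W l) (feature M W x l - feature M W' x l) +
          tProd M (W l - W' l) (feature M W' x l) := by
      rw [tProd_sub_left, tProd_sub_right]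
      abel
    rw [Finset.prod_range_succ, feature, feature]
    calc _ ≤ frobNorm (W l) * frobNorm (feature M W x l - feature M W' x l) +
          frobNorm (W l - W' l) * frobNorm (feature M W' x l) := by
            refine (frobNorm_relu_sub_le _ _).trans ?_
            rw [hsplit]
            exact (frobNorm_add_le _ _).trans
              (add_le_add (frobNorm_tProd_le hM _ _) (frobNorm_tProd_le hM _ _))
      _ ≤ Bl l * (l * δ * ((∏ k ∈ Finset.range l, Bl k) * frobNorm x)) +
          δ * Bl l * ((∏ k ∈ Finset.range l, Bl k) * frobNorm x) := by
            refine add_le_add ?_ ?_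
            · exact mul_le_mul hl ih (frobNorm_nonneg _) ((frobNorm_nonneg _).trans hl)
            · exact mul_le_mul (hδ l hlt) hf (frobNorm_nonneg _)
                ((frobNorm_nonneg _).trans (hδ l hlt))
      _ = _ := by
            push_cast
            ring

theorem abs_predictor_le (hM : M ∈ Matrix.orthogonalGroup (Fin c) ℝ) {Bw : ℝ}
    {w : EuclideanSpace ℝ (Fin (d L) × Fin 1 × Fin c)} (hw : ‖w‖ ≤ Bw)
    (hW : ∀ k < L, frobNorm (W k) ≤ Bl k) (x : Tensor (d 0) 1 c) :
    |predictor M L W w x| ≤ Bw * (∏ k ∈ Finset.range L, Bl k) * frobNorm x := by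
  refine (abs_real_inner_le_norm _ _).trans ?_
  rw [mul_assoc]
  exact mul_le_mul hw (frobNorm_feature_le hM x hW) (norm_nonneg _) ((norm_nonneg _).trans hw)

theorem abs_predictor_sub_le (hM : M ∈ Matrix.orthogonalGroup (Fin c) ℝ) {Bw δ : ℝ}
    {w w' : EuclideanSpace ℝ (Fin (d L) × Fin 1 × Fin c)} (hw : ‖w‖ ≤ Bw)
    (hwδ : ‖w - w'‖ ≤ δ * Bw) (hW : ∀ k < L, frobNorm (W k) ≤ Bl k)
    (hW' : ∀ k < L, frobNorm (W' k) ≤ Bl k) (hδ : ∀ k < L, frobNorm (W k - W' k) ≤ δ * Bl k)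
    (x : Tensor (d 0) 1 c) :
    |predictor M L W w x - predictor M L W' w' x| ≤
      (L + 1) * δ * (Bw * (∏ k ∈ Finset.range L, Bl k) * frobNorm x) := by
  have hsplit : predictor M L W w x - predictor M L W' w' x =
      inner ℝ w (vec (feature M W x L - feature M W' x L)) +
        inner ℝ (w - w') (vec (feature M W' x L)) := by
    rw [vec_sub, inner_sub_right, inner_sub_left, predictor, predictor]
    ring
  rw [hsplit]
  calc _ ≤ ‖w‖ * frobNorm (feature M W x L - feature M W' x L) +
        ‖w - w'‖ * frobNorm (feature M W' x L) :=
        (abs_add_le _ _).trans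
          (add_le_add (abs_real_inner_le_norm _ _) (abs_real_inner_le_norm _ _))
    _ ≤ Bw * (L * δ * ((∏ k ∈ Finset.range L, Bl k) * frobNorm x)) +
        δ * Bw * ((∏ k ∈ Finset.range L, Bl k) * frobNorm x) := by
        refine add_le_add ?_ ?_
        · exact mul_le_mul hw (frobNorm_feature_sub_le hM x hW hW' hδ) (frobNorm_nonneg _)
            ((norm_nonneg _).trans hw)
        · exact mul_le_mul hwδ (frobNorm_feature_le hM x hW') (frobNorm_nonneg _)
            ((norm_nonneg _).trans hwδ)
    _ = _ := by ring

end Network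

/-! ### The adversarial loss -/

section Adversary

variable {m c : ℕ} {R : Seminorm ℝ (Tensor m 1 c)} {φ : ℝ → ℝ} {ξ : ℝ}

theorem continuous_frobNorm {m n c : ℕ} : Continuous (frobNorm : Tensor m n c → ℝ) := by
  refine ((PiLp.continuous_toLp 2 _).comp ?_).norm
  fun_prop

theorem norm_le_frobNorm {m n c : ℕ} (x : Tensor m n c) : ‖x‖ ≤ frobNorm x := by
  refine (pi_norm_le_iff_of_nonneg (frobNorm_nonneg x)).2 fun i =>
    (pi_norm_le_iff_of_nonneg (frobNorm_nonneg x)).2 fun j =>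
    (pi_norm_le_iff_of_nonneg (frobNorm_nonneg x)).2 fun k => ?_
  exact PiLp.norm_apply_le (vec x) (i, j, k)

theorem continuous_seminorm (R : Seminorm ℝ (Tensor m 1 c)) : Continuous R :=
  continuousOn_univ.1 (R.convexOn.continuousOn isOpen_univ)

/-- The supremum that defines the compatibility constant is finite, because the ratio of the two
norms is homogeneous of degree zero and continuous on the compact unit sphere. -/
theorem frobNorm_le_compatConst_mul (hR : ∀ x, R x = 0 → x = 0) (x : Tensor m 1 c) :
    frobNorm x ≤ compatConst R * R x := by
  have hpos : ∀ x, x ≠ 0 → 0 < R x := fun x hx =>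
    lt_of_le_of_ne (apply_nonneg R x) fun h => hx (hR x h.symm)
  rcases eq_or_ne x 0 with rfl | hx
  · simp [frobNorm_zero]
  have hcont : ContinuousOn (fun x => frobNorm x / R x) (Metric.sphere (0 : Tensor m 1 c) 1) :=
    continuous_frobNorm.continuousOn.div (continuous_seminorm R).continuousOn fun x hx =>
      (hpos x (ne_zero_of_mem_unit_sphere ⟨x, hx⟩)).ne'
  obtain ⟨K, hK⟩ := (isCompact_sphere (0 : Tensor m 1 c) 1).bddAbove_image hcont
  have hbdd : BddAbove {r | ∃ x : Tensor m 1 c, x ≠ 0 ∧ r = frobNorm x / R x} := by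
    refine ⟨K, ?_⟩
    rintro _ ⟨x, hx, rfl⟩
    have hnx : ‖x‖ ≠ 0 := norm_ne_zero_iff.2 hx
    have hmem : ‖x‖⁻¹ • x ∈ Metric.sphere (0 : Tensor m 1 c) 1 := by
      rw [mem_sphere_zero_iff_norm, norm_smul, norm_inv, norm_norm, inv_mul_cancel₀ hnx]
    have hle := hK (mem_image_of_mem _ hmem)
    have hfrob : frobNorm (‖x‖⁻¹ • x) = ‖x‖⁻¹ * frobNorm x := by
      rw [frobNorm, show vec (‖x‖⁻¹ • x) = ‖x‖⁻¹ • vec x from rfl, norm_smul, norm_inv, norm_norm]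
      rfl
    rwa [hfrob, map_smul_eq_mul, norm_inv, norm_norm,
      mul_div_mul_left _ _ (inv_ne_zero hnx)] at hle
  rw [← div_le_iff₀ (hpos x hx)]
  exact le_csSup hbdd ⟨x, hx, rfl⟩

theorem compatConst_nonneg (R : Seminorm ℝ (Tensor m 1 c)) : 0 ≤ compatConst R := by
  refine Real.sSup_nonneg ?_
  rintro _ ⟨x, -, rfl⟩
  exact div_nonneg (frobNorm_nonneg x) (apply_nonneg R x)

theorem frobNorm_le_of_mem_advBall (hR : ∀ x, R x = 0 → x = 0) {Bx : ℝ} {x x' : Tensor m 1 c}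
    (hx : frobNorm x ≤ Bx) (hx' : x' ∈ advBall R ξ x) : frobNorm x' ≤ Bx + ξ * compatConst R := by
  have h1 : frobNorm x' ≤ frobNorm x + frobNorm (x' - x) := by
    simpa using frobNorm_add_le x (x' - x)
  have h2 := frobNorm_le_compatConst_mul hR (x' - x)
  have h3 : compatConst R * R (x' - x) ≤ compatConst R * ξ :=
    mul_le_mul_of_nonneg_left hx' (compatConst_nonneg R)
  linarith

theorem isCompact_advBall_zero (hR : ∀ x, R x = 0 → x = 0) (ξ : ℝ) :
    IsCompact (advBall R ξ 0) := by
  refine Metric.isCompact_of_isClosed_isBounded ?_ ?_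
  · exact isClosed_le ((continuous_seminorm R).comp (continuous_id.sub continuous_const))
      continuous_const
  · refine isBounded_iff_forall_norm_le.2 ⟨0 + ξ * compatConst R, fun x hx => ?_⟩
    exact (norm_le_frobNorm x).trans (frobNorm_le_of_mem_advBall hR frobNorm_zero.le hx)

theorem mem_advBall_self (hξ : 0 ≤ ξ) (x : Tensor m 1 c) : x ∈ advBall R ξ x := by
  simpa [advBall] using hξ

/-- The adversarial loss of a continuous predictor is continuous: it is a supremum over
perturbations in a fixed compact set. -/
theorem continuous_advLoss (hR : ∀ x, R x = 0 → x = 0) (hφ : Continuous φ)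
    {f : Tensor m 1 c → ℝ} (hf : Continuous f) : Continuous (advLoss φ R ξ f) := by
  have htrans : advLoss φ R ξ f = fun z =>
      sSup ((fun u => loss φ (f (z.1 + u)) z.2) '' advBall R ξ 0) := by
    funext z
    have hball : advBall R ξ z.1 = (fun u => z.1 + u) '' advBall R ξ 0 := by
      ext x'
      simp [advBall, sub_eq_neg_add]
    rw [advLoss, hball, image_image]
  rw [htrans]
  refine (isCompact_advBall_zero hR ξ).continuous_sSup ?_
  simp only [Function.HasUncurry.uncurry, id, loss]
  fun_prop

theorem abs_csSup_image_sub_le {X : Type*} {s : Set X} (hs : s.Nonempty) {g g' : X → ℝ}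
    (hg : BddAbove (g '' s)) (hg' : BddAbove (g' '' s)) {δ : ℝ} (h : ∀ x ∈ s, |g x - g' x| ≤ δ) :
    |sSup (g '' s) - sSup (g' '' s)| ≤ δ := by
  rw [abs_sub_le_iff]
  constructor
  · rw [sub_le_iff_le_add]
    refine csSup_le (hs.image g) ?_
    rintro _ ⟨x, hx, rfl⟩
    linarith [(abs_le.1 (h x hx)).2, le_csSup hg' (mem_image_of_mem g' hx)]
  · rw [sub_le_iff_le_add]
    refine csSup_le (hs.image g') ?_
    rintro _ ⟨x, hx, rfl⟩
    linarith [(abs_le.1 (h x hx)).1, le_csSup hg (mem_image_of_mem g hx)]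

theorem abs_loss_sub_le (hφ : ContDiff ℝ 1 φ) (hφ' : ∀ x, 0 ≤ deriv φ x) {b q q' y : ℝ}
    (hy : y = 1 ∨ y = -1) (hq : |q| ≤ b) (hq' : |q'| ≤ b) :
    |loss φ q y - loss φ q' y| ≤ lossLip φ b * |q - q'| := by
  have hcont : Continuous fun q => deriv φ q * Real.exp (-φ q) :=
    (hφ.continuous_deriv le_rfl).mul (Real.continuous_exp.comp hφ.continuous.neg)
  have hbdd : BddAbove ((fun q => deriv φ q * Real.exp (-φ q)) '' Icc (-b) b) :=
    isCompact_Icc.bddAbove_image hcont.continuousOn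
  have hder : ∀ q, HasDerivAt (fun q => Real.exp (-φ q)) (Real.exp (-φ q) * -deriv φ q) q :=
    fun q => ((hφ.differentiable one_ne_zero q).hasDerivAt.neg).exp
  have habs : |y| = 1 := by rcases hy with rfl | rfl <;> simp
  have hmem : ∀ q, |q| ≤ b → y * q ∈ Icc (-b) b := fun q hq => by
    rw [mem_Icc, ← abs_le, abs_mul, habs, one_mul]
    exact hq
  have := Convex.norm_image_sub_le_of_norm_deriv_le (𝕜 := ℝ) (C := lossLip φ b)
    (fun q _ => (hder q).differentiableAt) (fun q hq => ?_) (convex_Icc (-b) b) (hmem q' hq')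
    (hmem q hq)
  · rwa [← mul_sub, norm_mul, Real.norm_eq_abs y, habs, one_mul] at this
  · rw [(hder q).deriv, norm_mul, norm_neg, Real.norm_of_nonneg (Real.exp_pos _).le,
      Real.norm_of_nonneg (hφ' q), mul_comm]
    exact le_csSup hbdd ⟨q, hq, rfl⟩

theorem lossLip_nonneg (hφ' : ∀ x, 0 ≤ deriv φ x) (b : ℝ) : 0 ≤ lossLip φ b := by
  refine Real.sSup_nonneg ?_
  rintro _ ⟨q, -, rfl⟩
  exact mul_nonneg (hφ' q) (Real.exp_pos _).le

theorem advLoss_mem_Icc (hξ : 0 ≤ ξ) {B : ℝ} {f : Tensor m 1 c → ℝ} {z : Tensor m 1 c × ℝ}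
    (h : ∀ x' ∈ advBall R ξ z.1, loss φ (f x') z.2 ∈ Icc 0 B) :
    advLoss φ R ξ f z ∈ Icc 0 B := by
  constructor
  · refine Real.sSup_nonneg ?_
    rintro _ ⟨x', hx', rfl⟩
    exact (h x' hx').1
  · refine csSup_le (Set.Nonempty.image _ ⟨z.1, mem_advBall_self hξ z.1⟩) ?_
    rintro _ ⟨x', hx', rfl⟩
    exact (h x' hx').2

theorem abs_advLoss_sub_le (hφ : ContDiff ℝ 1 φ) (hφ' : ∀ x, 0 ≤ deriv φ x) (hξ : 0 ≤ ξ)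
    {B b δ : ℝ} {f f' : Tensor m 1 c → ℝ} {z : Tensor m 1 c × ℝ} (hz : z.2 = 1 ∨ z.2 = -1)
    (h : ∀ x' ∈ advBall R ξ z.1, loss φ (f x') z.2 ∈ Icc 0 B)
    (h' : ∀ x' ∈ advBall R ξ z.1, loss φ (f' x') z.2 ∈ Icc 0 B)
    (hf : ∀ x' ∈ advBall R ξ z.1, |f x'| ≤ b) (hf' : ∀ x' ∈ advBall R ξ z.1, |f' x'| ≤ b)
    (hδ : ∀ x' ∈ advBall R ξ z.1, |f x' - f' x'| ≤ δ) :
    |advLoss φ R ξ f z - advLoss φ R ξ f' z| ≤ lossLip φ b * δ := by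
  refine abs_csSup_image_sub_le ⟨z.1, mem_advBall_self hξ z.1⟩ ⟨B, ?_⟩ ⟨B, ?_⟩ fun x' hx' => ?_
  · rintro _ ⟨x', hx', rfl⟩
    exact (h x' hx').2
  · rintro _ ⟨x', hx', rfl⟩
    exact (h' x' hx').2
  · exact (abs_loss_sub_le hφ hφ' hz (hf x' hx') (hf' x' hx')).trans
      (mul_le_mul_of_nonneg_left (hδ x' hx') (lossLip_nonneg hφ' b))

end Adversary

/-! ### The class of t-NNs as the image of a unit ball -/

section Parameters

variable {c L : ℕ} {d : ℕ → ℕ} {M : Matrix (Fin c) (Fin c) ℝ} {Bw : ℝ} {Bl : ℕ → ℝ}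

/-- Weights of a t-NN in vectorized form, with the classification weight as second component. In
the maximum of the Euclidean norms of the components, the unit ball is the set of weights whose
components are, after normalization by the bounds `Bl` and `Bw`, of norm at most one. -/
abbrev ParamSpace (c L : ℕ) (d : ℕ → ℕ) : Type :=
  ((l : Fin L) → EuclideanSpace ℝ (Fin (d (l + 1)) × Fin (d l) × Fin c)) ×
    EuclideanSpace ℝ (Fin (d L) × Fin 1 × Fin c)

theorem finrank_paramSpace (c L : ℕ) (d : ℕ → ℕ) :
    Module.finrank ℝ (ParamSpace c L d) =
      c * (∑ l ∈ Finset.range L, d l * d (l + 1)) + c * d L := by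
  simp only [ParamSpace, Module.finrank_prod, Module.finrank_pi_fintype, finrank_euclideanSpace,
    Fintype.card_prod, Fintype.card_fin, one_mul]
  rw [Fin.sum_univ_eq_sum_range (fun l => d (l + 1) * (d l * c)), Finset.mul_sum, mul_comm c (d L)]
  congr 1
  exact Finset.sum_congr rfl fun l _ => by ring

/-- The classification weight accounts for at most half of the parameters, since the last layer
already has `c d_{L-1} d_L` of them. -/
theorem finrank_paramSpace_le (hL : 0 < L) (hd : ∀ l ≤ L, 0 < d l) :
    Module.finrank ℝ (ParamSpace c L d) ≤ 2 * (c * ∑ l ∈ Finset.range L, d l * d (l + 1)) := by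
  rw [finrank_paramSpace, two_mul]
  refine Nat.add_le_add_left (Nat.mul_le_mul_left c ?_) _
  obtain ⟨k, rfl⟩ := Nat.exists_eq_succ_of_ne_zero hL.ne'
  calc d (k + 1) ≤ d k * d (k + 1) := Nat.le_mul_of_pos_left _ (hd k (Nat.le_succ k))
    _ ≤ _ := Finset.single_le_sum (f := fun l => d l * d (l + 1)) (fun _ _ => Nat.zero_le _)
      (Finset.self_mem_range_succ k)

/-- The weight tensors with normalized parameters `θ`. The layers from `L` on, which do not enter
the predictor, are zero. -/
def layerWeight (Bl : ℕ → ℝ) (θ : ParamSpace c L d) (l : ℕ) : Tensor (d (l + 1)) (d l) c :=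
  fun i j k => if h : l < L then Bl l * θ.1 ⟨l, h⟩ (i, j, k) else 0

theorem vec_layerWeight (θ : ParamSpace c L d) {l : ℕ} (h : l < L) :
    vec (layerWeight Bl θ l) = Bl l • θ.1 ⟨l, h⟩ := by
  ext p
  simp [vec, layerWeight, h]

theorem frobNorm_layerWeight_sub_le (θ θ' : ParamSpace c L d) {l : ℕ} (h : l < L)
    (hB : 0 ≤ Bl l) :
    frobNorm (layerWeight Bl θ l - layerWeight Bl θ' l) ≤ ‖θ - θ'‖ * Bl l := by
  rw [frobNorm, vec_sub, vec_layerWeight θ h, vec_layerWeight θ' h, ← smul_sub, norm_smul,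
    Real.norm_of_nonneg hB, mul_comm]
  refine mul_le_mul_of_nonneg_right ?_ hB
  exact (norm_le_pi_norm ((θ - θ').1) ⟨l, h⟩).trans (norm_fst_le _)

theorem frobNorm_layerWeight_le {θ : ParamSpace c L d} (hθ : ‖θ‖ ≤ 1) {l : ℕ} (h : l < L)
    (hB : 0 ≤ Bl l) : frobNorm (layerWeight Bl θ l) ≤ Bl l := by
  rw [frobNorm, vec_layerWeight θ h, norm_smul, Real.norm_of_nonneg hB]
  refine mul_le_of_le_one_right hB ?_
  exact (norm_le_pi_norm θ.1 ⟨l, h⟩).trans ((norm_fst_le θ).trans hθ)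

theorem norm_smul_snd_le {θ : ParamSpace c L d} (hθ : ‖θ‖ ≤ 1) (hBw : 0 ≤ Bw) :
    ‖Bw • θ.2‖ ≤ Bw := by
  rw [norm_smul, Real.norm_of_nonneg hBw]
  exact mul_le_of_le_one_right hBw ((norm_snd_le θ).trans hθ)

/-- The predictor with normalized parameters `θ`. -/
noncomputable def paramPredictor (M : Matrix (Fin c) (Fin c) ℝ) (Bw : ℝ) (Bl : ℕ → ℝ)
    (θ : ParamSpace c L d) :
    Tensor (d 0) 1 c → ℝ :=
  predictor M L (layerWeight Bl θ) (Bw • θ.2)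

theorem paramPredictor_mem_tnnClass (hBw : 0 ≤ Bw) (hBl : ∀ l < L, 0 ≤ Bl l)
    {θ : ParamSpace c L d} (hθ : ‖θ‖ ≤ 1) : paramPredictor M Bw Bl θ ∈ tnnClass d M L Bw Bl :=
  ⟨_, _, norm_smul_snd_le hθ hBw, fun l hl => frobNorm_layerWeight_le hθ hl (hBl l hl), rfl⟩

theorem exists_paramPredictor_eq (hBw : 0 < Bw) (hBl : ∀ l < L, 0 < Bl l)
    {f : Tensor (d 0) 1 c → ℝ} (hf : f ∈ tnnClass d M L Bw Bl) :
    ∃ θ : ParamSpace c L d, ‖θ‖ ≤ 1 ∧ f = paramPredictor M Bw Bl θ := by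
  obtain ⟨W, w, hw, hW, rfl⟩ := hf
  refine ⟨(fun l => (Bl l)⁻¹ • vec (W l), Bw⁻¹ • w), ?_, ?_⟩
  · refine norm_prod_le_iff.2 ⟨(pi_norm_le_iff_of_nonneg zero_le_one).2 fun l => ?_, ?_⟩
    · rw [norm_smul, norm_inv, Real.norm_of_nonneg (hBl l l.2).le]
      exact inv_mul_le_one_of_le₀ (hW l l.2) (hBl l l.2).le
    · rw [norm_smul, norm_inv, Real.norm_of_nonneg hBw.le]
      exact inv_mul_le_one_of_le₀ hw hBw.le
  · funext x
    rw [paramPredictor, predictor, predictor, smul_inv_smul₀ hBw.ne']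
    congr 2
    refine feature_congr x fun l hl => ?_
    funext i j k
    have := (hBl l hl).ne'
    simp [layerWeight, hl, vec, this]

theorem abs_paramPredictor_sub_le (hM : M ∈ Matrix.orthogonalGroup (Fin c) ℝ) (hBw : 0 ≤ Bw)
    (hBl : ∀ l < L, 0 ≤ Bl l) {θ θ' : ParamSpace c L d} (hθ : ‖θ‖ ≤ 1) (hθ' : ‖θ'‖ ≤ 1)
    (x : Tensor (d 0) 1 c) :
    |paramPredictor M Bw Bl θ x - paramPredictor M Bw Bl θ' x| ≤
      (L + 1) * ‖θ - θ'‖ * (Bw * (∏ k ∈ Finset.range L, Bl k) * frobNorm x) := by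
  refine abs_predictor_sub_le hM (norm_smul_snd_le hθ hBw) ?_
    (fun l hl => frobNorm_layerWeight_le hθ hl (hBl l hl))
    (fun l hl => frobNorm_layerWeight_le hθ' hl (hBl l hl))
    (fun l hl => frobNorm_layerWeight_sub_le θ θ' hl (hBl l hl)) x
  rw [← smul_sub, norm_smul, Real.norm_of_nonneg hBw, mul_comm]
  exact mul_le_mul_of_nonneg_right (norm_snd_le (θ - θ')) hBw

theorem paramPredictor_zero (x : Tensor (d 0) 1 c) :
    paramPredictor M Bw Bl (0 : ParamSpace c L d) x = 0 := by
  simp [paramPredictor, predictor]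

end Parameters

end TNN

/-! ### The generalization bound -/

theorem mainTheorem2 :
    ∃ C : ℝ, 0 < C ∧
      ∀ (c L N : ℕ) (d : ℕ → ℕ), 0 < c → 0 < L → 0 < N → (∀ l ≤ L, 0 < d l) →
      ∀ M ∈ Matrix.orthogonalGroup (Fin c) ℝ,
      ∀ (Bw Bx ξ B : ℝ) (Bl : ℕ → ℝ), 0 < Bw → (∀ l < L, 0 < Bl l) → 0 < Bx → 0 ≤ ξ →
      ∀ R : Seminorm ℝ (TNN.Tensor (d 0) 1 c), (∀ x, R x = 0 → x = 0) →
      ∀ φ : ℝ → ℝ,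
        TNN.LossAssumption φ (TNN.tnnClass d M L Bw Bl)
          {x' | ∃ x, TNN.frobNorm x ≤ Bx ∧ x' ∈ TNN.advBall R ξ x} B →
      ∀ P : Measure (TNN.Tensor (d 0) 1 c × ℝ), IsProbabilityMeasure P →
        (∀ᵐ z ∂P, TNN.frobNorm z.1 ≤ Bx ∧ (z.2 = 1 ∨ z.2 = -1)) →
      ∀ t : ℝ, 0 < t →
        ENNReal.ofReal (1 - 2 * Real.exp (-t)) ≤
          Measure.pi (fun _ : Fin N => P)
            {S | ∀ f ∈ TNN.tnnClass d M L Bw Bl,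
              TNN.advRisk φ R ξ P f - TNN.empAdvRisk φ R ξ S f ≤
                C * TNN.lossLip φ (TNN.outputBound R ξ Bx Bw L Bl) *
                    TNN.outputBound R ξ Bx Bw L Bl / √N *
                    √(c * (∑ l ∈ Finset.range L, (d l : ℝ) * d (l + 1)) *
                      Real.log (3 * (L + 1))) +
                  3 * B * √(t / (2 * N))} := by
  open TNN in
  refine ⟨27, by norm_num, ?_⟩
  intro c L N d hc hL hN hd M hM Bw Bx ξ B Bl hBw hBl hBx hξ R hR φ hφ P hP hPx t ht
  set b := outputBound R ξ Bx Bw L Bl with hb_def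
  set Λ := lossLip φ b with hΛ_def
  have hΛ0 : 0 ≤ Λ := lossLip_nonneg hφ.deriv_nonneg b
  have hprod : 0 < ∏ l ∈ Finset.range L, Bl l :=
    Finset.prod_pos fun l hl => hBl l (Finset.mem_range.1 hl)
  have hBl' : ∀ l < L, 0 ≤ Bl l := fun l hl => (hBl l hl).le
  have hC0 := compatConst_nonneg R
  have hb : 0 < b := by
    rw [hb_def, outputBound]
    positivity
  let ball := Metric.closedBall (0 : ParamSpace c L d) 1
  have hball : ∀ θ : ball, ‖(θ : ParamSpace c L d)‖ ≤ 1 := fun θ => mem_closedBall_zero_iff.1 θ.2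
  let θ₀ : ball := ⟨0, by simp [ball]⟩
  let G : ball → Tensor (d 0) 1 c × ℝ → ℝ := fun θ =>
    advLoss φ R ξ (paramPredictor M Bw Bl (θ : ParamSpace c L d))
  let Z₀ : Set (Tensor (d 0) 1 c × ℝ) := {z | frobNorm z.1 ≤ Bx ∧ (z.2 = 1 ∨ z.2 = -1)}
  have hZ₀ : ∀ᵐ z ∂P, z ∈ Z₀ := hPx
  have hG : ∀ θ, AEMeasurable (G θ) P := fun θ =>
    (continuous_advLoss hR hφ.smooth.continuous
      (continuous_predictor _ _ _ _)).measurable.aemeasurable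
  have hrange : ∀ θ : ball, ∀ z ∈ Z₀, ∀ x' ∈ advBall R ξ z.1,
      loss φ (paramPredictor M Bw Bl (θ : ParamSpace c L d) x') z.2 ∈ Icc 0 B :=
    fun θ z hz x' hx' => hφ.range _ (paramPredictor_mem_tnnClass hBw.le hBl' (hball θ)) x'
      ⟨z.1, hz.1, hx'⟩ z.2 hz.2
  have hGB : ∀ θ, ∀ z ∈ Z₀, G θ z ∈ Icc 0 B := fun θ z hz =>
    advLoss_mem_Icc hξ (hrange θ z hz)
  have hout : ∀ z ∈ Z₀, ∀ x' ∈ advBall R ξ z.1,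
      Bw * (∏ l ∈ Finset.range L, Bl l) * frobNorm x' ≤ b := by
    intro z hz x' hx'
    rw [hb_def, outputBound, mul_comm]
    exact mul_le_mul_of_nonneg_right (frobNorm_le_of_mem_advBall hR hz.1 hx') (by positivity)
  have hpred : ∀ θ : ball, ∀ z ∈ Z₀, ∀ x' ∈ advBall R ξ z.1,
      |paramPredictor M Bw Bl (θ : ParamSpace c L d) x'| ≤ b := fun θ z hz x' hx' =>
    (abs_predictor_le hM (norm_smul_snd_le (hball θ) hBw.le)
      (fun l hl => frobNorm_layerWeight_le (hball θ) hl (hBl' l hl)) x').trans (hout z hz x' hx')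
  have hGsub : ∀ (θ θ' : ball) (δ : ℝ), ∀ z ∈ Z₀, (∀ x' ∈ advBall R ξ z.1,
      |paramPredictor M Bw Bl (θ : ParamSpace c L d) x' -
        paramPredictor M Bw Bl (θ' : ParamSpace c L d) x'| ≤ δ) → |G θ z - G θ' z| ≤ Λ * δ :=
    fun θ θ' δ z hz hδ => abs_advLoss_sub_le hφ.smooth hφ.deriv_nonneg hξ hz.2 (hrange θ z hz)
      (hrange θ' z hz) (hpred θ z hz) (hpred θ' z hz) hδ
  have hθ₀ : ∀ θ, ∀ z ∈ Z₀, |G θ z - G θ₀ z| ≤ Λ * b := fun θ z hz =>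
    hGsub θ θ₀ b z hz fun x' hx' => by
      rw [paramPredictor_zero, sub_zero]
      exact hpred θ z hz x' hx'
  have hlip : ∀ θ θ' : ball, ∀ z ∈ Z₀, |G θ z - G θ' z| ≤
      ((L : ℝ) + 1) * (Λ * b) * ‖(θ : ParamSpace c L d) - θ'‖ := by
    intro θ θ' z hz
    refine (hGsub θ θ' (((L : ℝ) + 1) * ‖(θ : ParamSpace c L d) - θ'‖ * b) z hz
      fun x' hx' => ?_).trans (le_of_eq (by ring))
    exact (abs_paramPredictor_sub_le hM hBw.le hBl' (hball θ) (hball θ') x').trans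
      (mul_le_mul_of_nonneg_left (hout z hz x' hx') (by positivity))
  set D' : ℝ := c * ∑ l ∈ Finset.range L, (d l : ℝ) * d (l + 1) with hD'
  have hlog : 0 ≤ Real.log (3 * (L + 1)) := Real.log_nonneg (by
    have : (0 : ℝ) ≤ L := Nat.cast_nonneg L
    linarith)
  have hgap : ENNReal.ofReal (1 - 2 * Real.exp (-t)) ≤ Measure.pi (fun _ : Fin N => P)
      {S | ∀ θ, gap P (G θ) S ≤ 27 * Λ * b / √N * √(D' * Real.log (3 * (L + 1))) +
        3 * B * √(t / (2 * N))} := by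
    rcases hΛ0.eq_or_lt with hΛ | hΛ
    · -- The loss is constant on the range of the predictors, so that all gaps vanish.
      have hconst : ∀ θ, ∀ z ∈ Z₀, |G θ z - Real.exp (-φ 0)| ≤ 0 := by
        intro θ z hz
        have h0 : G θ₀ z = Real.exp (-φ 0) := by
          have : (fun x' => loss φ (paramPredictor M Bw Bl (0 : ParamSpace c L d) x') z.2) =
              fun _ => Real.exp (-φ 0) := by
            funext x'
            rw [paramPredictor_zero, loss, mul_zero]
          change sSup ((fun x' => loss φ (paramPredictor M Bw Bl (0 : ParamSpace c L d) x') z.2) ''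
            advBall R ξ z.1) = _
          rw [this, Set.Nonempty.image_const ⟨z.1, mem_advBall_self hξ z.1⟩, csSup_singleton]
        have := hθ₀ θ z hz
        rwa [← hΛ, zero_mul, h0] at this
      have hae : ∀ᵐ S ∂Measure.pi (fun _ : Fin N => P), ∀ θ, gap P (G θ) S ≤
          27 * Λ * b / √N * √(D' * Real.log (3 * (L + 1))) + 3 * B * √(t / (2 * N)) := by
        have hS : ∀ᵐ S ∂Measure.pi (fun _ : Fin N => P), ∀ i, S i ∈ Z₀ :=
          ae_all_iff.2 fun i =>
            (measurePreserving_eval (fun _ : Fin N => P) i).quasiMeasurePreserving.ae hZ₀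
        filter_upwards [hS] with S hS θ
        have hle := gap_le_gap_add hN (Integrable.of_mem_Icc 0 B (hG θ) (hZ₀.mono (hGB θ)))
          (integrable_const (Real.exp (-φ 0))) hZ₀ (hconst θ) hS
        have hgap0 : gap P (fun _ => Real.exp (-φ 0)) S = 0 := by
          have hN' : (N : ℝ) ≠ 0 := by exact_mod_cast hN.ne'
          simp [gap, hN']
        have hB := hφ.pos
        refine hle.trans ?_
        rw [hgap0, mul_zero, add_zero]
        positivity
      rw [measure_congr (eventuallyEq_univ.2 hae), measure_univ]
      exact ENNReal.ofReal_le_one.2 (by linarith [Real.exp_pos (-t)])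
    · have hfin : 0 < Module.finrank ℝ (ParamSpace c L d) := by
        rw [finrank_paramSpace]
        have := Nat.mul_pos hc (hd L le_rfl)
        omega
      refine (measure_forall_gap_le_of_lipschitz hN (ParamSpace c L d) hfin hG hZ₀ hφ.pos
        (mul_pos hΛ hb) (le_add_of_nonneg_left (Nat.cast_nonneg L)) hGB θ₀ hθ₀ hlip ht).trans
        (measure_mono fun S hS θ => (hS θ).trans ?_)
      have hdim : (Module.finrank ℝ (ParamSpace c L d) : ℝ) ≤ 2 * D' := by
        rw [hD']
        exact_mod_cast finrank_paramSpace_le (c := c) hL hd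
      have hsqrt : √(Module.finrank ℝ (ParamSpace c L d) * Real.log (3 * (L + 1))) ≤
          √2 * √(D' * Real.log (3 * (L + 1))) := by
        rw [← Real.sqrt_mul zero_le_two, ← mul_assoc]
        exact Real.sqrt_le_sqrt (mul_le_mul_of_nonneg_right hdim hlog)
      gcongr
      calc _ ≤ 27 * (Λ * b) * (√2 * √(D' * Real.log (3 * (L + 1)))) / √(2 * N) := by gcongr
        _ = _ := by
          rw [Real.sqrt_mul zero_le_two]
          field_simp
  refine hgap.trans (measure_mono fun S hS f hf => ?_)
  obtain ⟨θ, hθ, rfl⟩ := exists_paramPredictor_eq hBw hBl hf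
  exact hS ⟨θ, mem_closedBall_zero_iff.2 hθ⟩
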